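/- Let $(M^m,g,J)$ be a Kähler manifold of real dimension $m$, with Levi-Civita connection $\nabla$, and let $\varphi:M\to(N^{m-1},h)$ be a smooth submersion into a Riemannian manifold of dimension $m-1$ whose (one-dimensional) fibres are spanned by a vector field $V=\operatorname{grad}F$, i.e. $\ker \mathrm d\varphi_x=\mathbb{R}\,V_x$ for every $x\in M$, where $F$ is a positive smooth function on $M$. Suppose that $V$ is a (real) holomorphic vector field, i.e. $\mathcal L_VJ=0$. For $x\in M$ let $\lambda_1(x),\dots,\lambda_{m-1}(x)>0$ be the square roots of the nonzero eigenvalues, counted with multiplicity, of $\varphi^*h$ with respect to $g$; that is, $T_xM$ has a $g$-orthonormal basis $E_1,\dots,E_{m-1},U$ with $\mathrm d\varphi(U)=0$ and $(\varphi^*h)(E_i,X)=\lambda_i^2\,g(E_i,X)$ for all $X\in T_xM$. Assume that on $M$ $$\prod_{i=1}^{m-1}\lambda_i=F^{\frac{4}{m-6}}\,|\operatorname{grad}F|\quad\text{if } m\neq 6,\qquad\qquad \prod_{i=1}^{5}\lambda_i=e^{2F}\,|\operatorname{grad}F|\quad\text{if } m=6 .$$ Put $\gamma=\tfrac{2}{m-6}\ln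 F$ if $m\neq6$, and $\gamma=F$ if $m=6$. Then $\gamma$ is a smooth function on $M$ such that $J\big(e^{\frac{m-6}{2}\gamma}\operatorname{grad}\gamma\big)$ is a Killing vector field of $g$, and $$\Delta\gamma+\tfrac{m-2}{2}\,|\operatorname{grad}\gamma|^2=0,\qquad \Delta\gamma=\operatorname{tr}\nabla\mathrm d\gamma .$$ -/

import Mathlib

open Bundle Manifold
open scoped ContDiff Topology

noncomputable section

namespace KahlerSubmersion

section Fields

variable {E : Type*} [NormedAddCommGroup E] [NormedSpace ℝ E]
  {M : Type*} [TopologicalSpace M] [ChartedSpace E M] [IsManifold 𝓘(ℝ, E) ∞ M]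

/-- The vector field `X` is of class `C^∞` at `x`. -/
def SmoothFieldAt (X : (x : M) → TangentSpace 𝓘(ℝ, E) x) (x : M) : Prop :=
  ContMDiffAt 𝓘(ℝ, E) 𝓘(ℝ, E).tangent ∞ (fun y => (⟨y, X y⟩ : TangentBundle 𝓘(ℝ, E) M)) x

/-- The field of endomorphisms `J` of the tangent spaces is smooth. -/
def SmoothEndField
    (J : (x : M) → TangentSpace 𝓘(ℝ, E) x →L[ℝ] TangentSpace 𝓘(ℝ, E) x) : Prop :=
  ContMDiff 𝓘(ℝ, E) (𝓘(ℝ, E).prod 𝓘(ℝ, E →L[ℝ] E)) ∞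
    (fun x => TotalSpace.mk' (E →L[ℝ] E)
      (E := fun x : M => TangentSpace 𝓘(ℝ, E) x →L[ℝ] TangentSpace 𝓘(ℝ, E) x) x (J x))

/-- The vector field `V` is (real) holomorphic with respect to `J`: it is smooth and
`𝓛_V J = 0`, i.e. `[V, JX] = J[V, X]` at `x` for all vector fields `X` smooth at `x`. -/
def IsHolomorphicField
    (J : (x : M) → TangentSpace 𝓘(ℝ, E) x →L[ℝ] TangentSpace 𝓘(ℝ, E) x)
    (V : (x : M) → TangentSpace 𝓘(ℝ, E) x) : Prop :=
  (∀ x, SmoothFieldAt V x) ∧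
  ∀ (x : M) (X : (x : M) → TangentSpace 𝓘(ℝ, E) x), SmoothFieldAt X x →
    VectorField.mlieBracket 𝓘(ℝ, E) V (fun y => J y (X y)) x =
      J x (VectorField.mlieBracket 𝓘(ℝ, E) V X x)

end Fields

section Metric

variable {E : Type*} [NormedAddCommGroup E] [NormedSpace ℝ E]
  {M : Type*} [TopologicalSpace M] [ChartedSpace E M] [IsManifold 𝓘(ℝ, E) ∞ M]
  (g : ContMDiffRiemannianMetric 𝓘(ℝ, E) ∞ E (fun x : M => TangentSpace 𝓘(ℝ, E) x))

/-- The musical isomorphism `♯ : T*M → TM`, the inverse of `v ↦ g(v, ·)`. -/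
def sharp (x : M) : (TangentSpace 𝓘(ℝ, E) x →L[ℝ] ℝ) →L[ℝ] TangentSpace 𝓘(ℝ, E) x :=
  (g.inner x).inverse

/-- In finite dimension `v ↦ g(v, ·)` is invertible, so that `sharp` is its true inverse. -/
theorem inner_isInvertible [FiniteDimensional ℝ E] (x : M) : (g.inner x).IsInvertible := by
  let B : E →L[ℝ] E →L[ℝ] ℝ := g.inner x
  have inj : Function.Injective B.toLinearMap := by
    rw [injective_iff_map_eq_zero]
    intro v hv
    by_contra hne
    have hpos := g.pos x v hne
    have h2 : B v v = 0 := by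
      have h3 : B v = 0 := hv
      rw [h3]; rfl
    exact absurd h2 hpos.ne'
  have hfr : Module.finrank ℝ E = Module.finrank ℝ (E →L[ℝ] ℝ) := by
    rw [LinearMap.toContinuousLinearMap.symm.finrank_eq]
    exact (Subspace.dual_finrank_eq (K := ℝ) (V := E)).symm
  let e : E ≃L[ℝ] (E →L[ℝ] ℝ) :=
    (LinearEquiv.ofInjectiveOfFinrankEq B.toLinearMap inj hfr).toContinuousLinearEquiv
  exact ⟨e, by ext; rfl⟩

theorem inner_sharp [FiniteDimensional ℝ E] (x : M) (α : TangentSpace 𝓘(ℝ, E) x →L[ℝ] ℝ)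
    (v : TangentSpace 𝓘(ℝ, E) x) : g.inner x (sharp g x α) v = α v := by
  obtain ⟨e, he⟩ := inner_isInvertible g x
  have key : g.inner x (sharp g x α) = α := by
    unfold sharp
    rw [← he]
    simp
  rw [key]

/-- The gradient of a function. -/
def grad (f : M → ℝ) (x : M) : TangentSpace 𝓘(ℝ, E) x :=
  sharp g x (mvfderiv 𝓘(ℝ, E) f x)

/-- The norm `|v| = √g(v, v)` of a tangent vector. -/
def gnorm {x : M} (v : TangentSpace 𝓘(ℝ, E) x) : ℝ :=
  Real.sqrt (g.inner x v v)

/-- The vector field `X` read in the preferred chart at `x₀`. -/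
def chartField (x₀ : M) (X : (x : M) → TangentSpace 𝓘(ℝ, E) x) : E → E :=
  VectorField.mpullback 𝓘(ℝ, E) 𝓘(ℝ, E) (extChartAt 𝓘(ℝ, E) x₀).symm X

/-- The metric read in the preferred chart at `x₀`: at a point `y` of the chart image
this is the bilinear form with matrix `(g_{ij}(y))`. -/
def chartMetric (x₀ : M) (y : E) : E →L[ℝ] E →L[ℝ] ℝ :=
  let A : E →L[ℝ] E := mfderiv 𝓘(ℝ, E) 𝓘(ℝ, E) (extChartAt 𝓘(ℝ, E) x₀).symm y
  let B : E →L[ℝ] E →L[ℝ] ℝ := g.inner ((extChartAt 𝓘(ℝ, E) x₀).symm y)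
  B.bilinearComp A A

/-- Christoffel symbols of the first kind at the centre of the preferred chart at `x₀`:
`christoffel g x₀ v u w = ½ (D_u g(v, w) + D_v g(u, w) - D_w g(v, u))`, i.e.
`Γ_{ij,k} = ½ (∂_i g_{jk} + ∂_j g_{ik} - ∂_k g_{ij})`. -/
def christoffel (x₀ : M) (v : E) : E →L[ℝ] E →L[ℝ] ℝ :=
  let D := fderiv ℝ (chartMetric g x₀) (extChartAt 𝓘(ℝ, E) x₀ x₀)
  (1 / 2 : ℝ) • (D.flip v + D v - (D.flip v).flip)

/-- The Levi-Civita covariant derivative `u ↦ ∇_u X` at the point `x`: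
in the preferred chart at `x` it is `D_u X + Γ(u, X)`. The tangent space `T_x M` is by
construction identified with `E` by the differential of this chart. -/
def nabla (X : (x : M) → TangentSpace 𝓘(ℝ, E) x) (x : M) :
    TangentSpace 𝓘(ℝ, E) x →L[ℝ] TangentSpace 𝓘(ℝ, E) x :=
  let D : E →L[ℝ] E := fderiv ℝ (chartField x X) (extChartAt 𝓘(ℝ, E) x x)
  let S : (E →L[ℝ] ℝ) →L[ℝ] E := sharp g x
  D + S ∘L christoffel g x (X x)

/-- The divergence `div X = tr (u ↦ ∇_u X)`. -/
def divergence (X : (x : M) → TangentSpace 𝓘(ℝ, E) x) (x : M) : ℝ :=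
  LinearMap.trace ℝ (TangentSpace 𝓘(ℝ, E) x) (nabla g X x).toLinearMap

/-- The Laplacian `Δ f = tr ∇ df = div (grad f)`. -/
def laplacian (f : M → ℝ) (x : M) : ℝ :=
  divergence g (grad g f) x

/-- `W` is a Killing vector field of `g`: it is smooth and `𝓛_W g = 0`, i.e.
`W(g(X, Y)) = g([W, X], Y) + g(X, [W, Y])` at `x` for all vector fields `X` and `Y`
smooth at `x`. -/
def IsKillingField (W : (x : M) → TangentSpace 𝓘(ℝ, E) x) : Prop :=
  (∀ x, SmoothFieldAt W x) ∧
  ∀ (x : M) (X Y : (x : M) → TangentSpace 𝓘(ℝ, E) x), SmoothFieldAt X x → SmoothFieldAt Y x →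
    mvfderiv 𝓘(ℝ, E) (fun y => g.inner y (X y) (Y y)) x (W x) =
      g.inner x (VectorField.mlieBracket 𝓘(ℝ, E) W X x) (Y x) +
        g.inner x (X x) (VectorField.mlieBracket 𝓘(ℝ, E) W Y x)

/-- `(M, g, J)` is a Kähler manifold: `J` is a smooth almost complex structure, `g` is Hermitian
with respect to `J`, and `∇J = 0` for the Levi-Civita connection `∇` of `g`. -/
structure IsKahler
    (J : (x : M) → TangentSpace 𝓘(ℝ, E) x →L[ℝ] TangentSpace 𝓘(ℝ, E) x) : Prop where
  smooth : SmoothEndField J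
  sq (x : M) (u : TangentSpace 𝓘(ℝ, E) x) : J x (J x u) = -u
  hermitian (x : M) (u v : TangentSpace 𝓘(ℝ, E) x) :
    g.inner x (J x u) (J x v) = g.inner x u v
  parallel (x : M) (X : (x : M) → TangentSpace 𝓘(ℝ, E) x) (hX : SmoothFieldAt X x)
    (u : TangentSpace 𝓘(ℝ, E) x) :
    nabla g (fun y => J y (X y)) x u = J x (nabla g X x u)

/-- The conditions on a function `γ` on a Kähler manifold `(M, g, J)` of real dimension `m` under
which holomorphic maps from `(M, e^{2γ} g, J)` are biharmonic: `γ` is smooth,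
`J (e^{(m - 6) γ / 2} grad γ)` is a Killing vector field of `g`, and
`Δγ + (m - 2)/2 |grad γ|² = 0`. -/
structure IsBiharmonicFactor (m : ℕ)
    (J : (x : M) → TangentSpace 𝓘(ℝ, E) x →L[ℝ] TangentSpace 𝓘(ℝ, E) x)
    (γ : M → ℝ) : Prop where
  smooth : ContMDiff 𝓘(ℝ, E) 𝓘(ℝ, ℝ) ∞ γ
  killing : IsKillingField g
    (fun x => J x (Real.exp (((m : ℝ) - 6) / 2 * γ x) • grad g γ x))
  laplace (x : M) : laplacian g γ x + ((m : ℝ) - 2) / 2 * gnorm g (grad g γ x) ^ 2 = 0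

variable {E' : Type*} [NormedAddCommGroup E'] [NormedSpace ℝ E']
  {N : Type*} [TopologicalSpace N] [ChartedSpace E' N] [IsManifold 𝓘(ℝ, E') ∞ N]
  (h : ContMDiffRiemannianMetric 𝓘(ℝ, E') ∞ E' (fun x : N => TangentSpace 𝓘(ℝ, E') x))

/-- For a map `φ : (M, g) → (N, h)` whose differential at `x` has one-dimensional kernel,
`lam 0, …, lam (k - 1) > 0` are the square roots of the nonzero eigenvalues of `φ*h` at `x` with
respect to `g`, counted with multiplicity: there is a `g`-orthonormal basis `e₀, …, e_{k-1}, u` of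
`T_x M` with `dφ(u) = 0` and `(φ*h)(e_i, X) = lam i ^ 2 * g(e_i, X)` for all `X`. -/
def IsPullbackSpectrum (φ : M → N) (x : M) {k : ℕ} (lam : Fin k → ℝ) : Prop :=
  (∀ i, 0 < lam i) ∧
  ∃ (e : Fin k → TangentSpace 𝓘(ℝ, E) x) (u : TangentSpace 𝓘(ℝ, E) x),
    (∀ i j, g.inner x (e i) (e j) = if i = j then 1 else 0) ∧
    (∀ i, g.inner x (e i) u = 0) ∧
    g.inner x u u = 1 ∧
    Submodule.span ℝ (insert u (Set.range e)) = ⊤ ∧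
    mfderiv 𝓘(ℝ, E) 𝓘(ℝ, E') φ x u = 0 ∧
    ∀ (i : Fin k) (X : TangentSpace 𝓘(ℝ, E) x),
      h.inner (φ x) (mfderiv 𝓘(ℝ, E) 𝓘(ℝ, E') φ x (e i)) (mfderiv 𝓘(ℝ, E) 𝓘(ℝ, E') φ x X) =
        lam i ^ 2 * g.inner x (e i) X

end Metric

end KahlerSubmersion

end

open KahlerSubmersion

open Bundle Manifold
open scoped ContDiff Topology

noncomputable section

/-! Killing part. Let `V = grad F`. The endomorphism `∇V` is symmetric because it is a Hessian, and
holomorphy of `V` together with `∇J = 0` makes it commute with the skew map `J`. Hence `∇(JV) = J∇V`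
is skew, which is Killing's equation (`IsKahler.isKillingField_grad`). The choice of `γ` makes
`e^{(m-6)γ/2} grad γ` a constant multiple of `grad F`.

Laplace part. In terms of `γ` the product of the `λ_i` is `c e^{aγ} |grad γ|` with `a = (m-2)/2`;
put now `V = grad γ`, which still spans the fibres. For every covector `θ`, `det(φ*h + θ⊗θ) = (∏
λ_i)² θ(u)² det g`, where `u` is the unit vector along `V`; since `θ(u)² = θ(V)²/|V|²`, the right
side is `(c e^{aγ})² θ(V)² det g`. The flow of `V` preserves `φ*h`, as `dφ(V) = 0`. Letting `θ` be
carried along to first order and differentiating along `V` gives `2 div V + V(log (c e^{aγ})²) = 0`,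
that is, `Δγ + a|grad γ|² = 0` (`divergence_formula`, `laplacian_of_jacobian`). Squares of Jacobians
replace volume forms, so no orientation is needed.

All local computations take place in the preferred chart at a point. Tangent vectors and forms are
retyped on the model space `E`, so that values at different points can be compared. -/

namespace KahlerSubmersion

/-! ### Vector fields and functions read in a preferred chart -/

section Chart

variable {E : Type*} [NormedAddCommGroup E] [NormedSpace ℝ E]
  {M : Type*} [TopologicalSpace M] [ChartedSpace E M]

/-- The differential of the inverse of the preferred chart at `x₀`, as an endomorphism of the
model space. -/
def chartDeriv (x₀ : M) (y : E) : E →L[ℝ] E :=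
  mfderiv 𝓘(ℝ, E) 𝓘(ℝ, E) (extChartAt 𝓘(ℝ, E) x₀).symm y

/-- The value of a vector field, as a vector of the model space. -/
def valueAt (X : (x : M) → TangentSpace 𝓘(ℝ, E) x) (x : M) : E := X x

/-- The Lie bracket of two vector fields, as a vector of the model space. -/
def bracketAt (V W : (x : M) → TangentSpace 𝓘(ℝ, E) x) (x : M) : E :=
  VectorField.mlieBracket 𝓘(ℝ, E) V W x

/-- The differential of a real function, as a linear form on the model space. -/
def diffAt (f : M → ℝ) (x : M) : E →L[ℝ] ℝ := mvfderiv 𝓘(ℝ, E) f x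

theorem eventually_mem_target (x₀ : M) :
    ∀ᶠ y in 𝓝 (extChartAt 𝓘(ℝ, E) x₀ x₀), y ∈ (extChartAt 𝓘(ℝ, E) x₀).target :=
  extChartAt_target_mem_nhds x₀

variable [IsManifold 𝓘(ℝ, E) ∞ M]

theorem contMDiffAt_symm (x₀ : M) {y : E} (hy : y ∈ (extChartAt 𝓘(ℝ, E) x₀).target) :
    ContMDiffAt 𝓘(ℝ, E) 𝓘(ℝ, E) ∞ (extChartAt 𝓘(ℝ, E) x₀).symm y :=
  (contMDiffOn_extChartAt_symm x₀).contMDiffAt ((isOpen_extChartAt_target x₀).mem_nhds hy)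

theorem chartDeriv_self (x₀ : M) :
    chartDeriv x₀ (extChartAt 𝓘(ℝ, E) x₀ x₀) = ContinuousLinearMap.id ℝ E := by
  have : IsManifold 𝓘(ℝ, E) 1 M := .of_le (n := ∞) (by norm_cast)
  have := mfderivWithin_range_extChartAt_symm (I := 𝓘(ℝ, E)) (x := x₀)
  simp only [modelWithCornersSelf_coe, Set.range_id, mfderivWithin_univ] at this
  exact this

/-- `chartField` uses the total function `inverse`, which is zero on non-invertible maps; this is
what makes it the true coordinate expression on the chart target. -/
theorem chartDeriv_isInvertible {x₀ : M} {y : E} (hy : y ∈ (extChartAt 𝓘(ℝ, E) x₀).target) :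
    (chartDeriv x₀ y).IsInvertible := by
  have : IsManifold 𝓘(ℝ, E) 1 M := .of_le (n := ∞) (by norm_cast)
  have := isInvertible_mfderivWithin_extChartAt_symm (I := 𝓘(ℝ, E)) hy
  simp only [modelWithCornersSelf_coe, Set.range_id, mfderivWithin_univ] at this
  exact this

omit [IsManifold 𝓘(ℝ, E) ∞ M] in
theorem chartField_eq (x₀ : M) (X : (x : M) → TangentSpace 𝓘(ℝ, E) x) (y : E) :
    chartField x₀ X y = (chartDeriv x₀ y).inverse (valueAt X ((extChartAt 𝓘(ℝ, E) x₀).symm y)) := rfl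

theorem chartDeriv_chartField {x₀ : M} (X : (x : M) → TangentSpace 𝓘(ℝ, E) x) {y : E}
    (hy : y ∈ (extChartAt 𝓘(ℝ, E) x₀).target) :
    chartDeriv x₀ y (chartField x₀ X y) = valueAt X ((extChartAt 𝓘(ℝ, E) x₀).symm y) := by
  rw [chartField_eq]
  obtain ⟨e, he⟩ := chartDeriv_isInvertible hy
  rw [← he, ContinuousLinearMap.inverse_equiv]
  exact e.apply_symm_apply _

theorem chartDeriv_injective {x₀ : M} {y : E} (hy : y ∈ (extChartAt 𝓘(ℝ, E) x₀).target) :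
    Function.Injective (chartDeriv x₀ y) := by
  obtain ⟨e, he⟩ := chartDeriv_isInvertible hy
  rw [← he]
  exact e.injective

theorem chartField_self (x₀ : M) (X : (x : M) → TangentSpace 𝓘(ℝ, E) x) :
    chartField x₀ X (extChartAt 𝓘(ℝ, E) x₀ x₀) = valueAt X x₀ := by
  have h := chartDeriv_chartField X (mem_extChartAt_target (I := 𝓘(ℝ, E)) x₀)
  rw [chartDeriv_self] at h
  rwa [extChartAt_to_inv] at h

theorem SmoothFieldAt.differentiableAt [CompleteSpace E] {x : M}
    {X : (x : M) → TangentSpace 𝓘(ℝ, E) x} (hX : SmoothFieldAt X x) :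
    DifferentiableAt ℝ (chartField x X) (extChartAt 𝓘(ℝ, E) x x) := by
  have : IsManifold 𝓘(ℝ, E) 2 M := .of_le (n := ∞) (by norm_cast)
  have h := (ContMDiffAt.mdifferentiableAt hX (by simp)).mdifferentiableWithinAt (s := Set.univ)
    |>.differentiableWithinAt_mpullbackWithin_vectorField
  simp only [modelWithCornersSelf_coe, Set.range_id, Set.preimage_univ, Set.univ_inter,
    VectorField.mpullbackWithin_univ] at h
  exact differentiableWithinAt_univ.1 h

theorem bracketAt_eq (V W : (x : M) → TangentSpace 𝓘(ℝ, E) x) (x : M) :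
    bracketAt V W x =
      fderiv ℝ (chartField x W) (extChartAt 𝓘(ℝ, E) x x) (valueAt V x) -
        fderiv ℝ (chartField x V) (extChartAt 𝓘(ℝ, E) x x) (valueAt W x) := by
  have : IsManifold 𝓘(ℝ, E) 1 M := .of_le (n := ∞) (by norm_cast)
  unfold bracketAt
  rw [← VectorField.mlieBracketWithin_univ, VectorField.mlieBracketWithin_apply,
    mfderiv_extChartAt_self]
  simp only [modelWithCornersSelf_coe, Set.range_id, Set.preimage_univ, Set.univ_inter,
    VectorField.mpullbackWithin_univ]
  have h1 : ∀ v : E, (ContinuousLinearMap.id ℝ E).inverse v = v := by simp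
  refine (h1 _).trans ?_
  have h2 : VectorField.lieBracketWithin ℝ (chartField x V) (chartField x W) Set.univ
      (extChartAt 𝓘(ℝ, E) x x) =
      fderiv ℝ (chartField x W) (extChartAt 𝓘(ℝ, E) x x) (valueAt V x) -
        fderiv ℝ (chartField x V) (extChartAt 𝓘(ℝ, E) x x) (valueAt W x) := by
    rw [VectorField.lieBracketWithin_univ, VectorField.lieBracket, chartField_self,
      chartField_self]
  exact h2

/-- Chain rule for a real function read in the preferred chart at `x₀`. -/
theorem fderiv_comp_symm {x₀ : M} {f : M → ℝ} (hf : ContMDiff 𝓘(ℝ, E) 𝓘(ℝ, ℝ) ∞ f) {y : E}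
    (hy : y ∈ (extChartAt 𝓘(ℝ, E) x₀).target) (u : E) :
    fderiv ℝ (f ∘ (extChartAt 𝓘(ℝ, E) x₀).symm) y u =
      diffAt f ((extChartAt 𝓘(ℝ, E) x₀).symm y) (chartDeriv x₀ y u) := by
  have h := mfderiv_comp y ((hf _).mdifferentiableAt (by simp))
    ((contMDiffAt_symm x₀ hy).mdifferentiableAt (by simp))
  rw [← mfderiv_eq_fderiv, h]
  rfl

theorem contDiffAt_comp_symm {x₀ : M} {f : M → ℝ}
    (hf : ContMDiff 𝓘(ℝ, E) 𝓘(ℝ, ℝ) ∞ f) {y : E}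
    (hy : y ∈ (extChartAt 𝓘(ℝ, E) x₀).target) :
    ContDiffAt ℝ ∞ (f ∘ (extChartAt 𝓘(ℝ, E) x₀).symm) y :=
  ((hf _).comp y (contMDiffAt_symm x₀ hy)).contDiffAt

omit [IsManifold 𝓘(ℝ, E) ∞ M] in
theorem diffAt_eq_fderiv {x : M} {f : M → ℝ} (hf : MDifferentiableAt 𝓘(ℝ, E) 𝓘(ℝ, ℝ) f x)
    (u : E) :
    diffAt f x u =
      fderiv ℝ (f ∘ (extChartAt 𝓘(ℝ, E) x).symm) (extChartAt 𝓘(ℝ, E) x x) u := by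
  have h : mfderiv 𝓘(ℝ, E) 𝓘(ℝ, ℝ) f x =
      fderiv ℝ (f ∘ (extChartAt 𝓘(ℝ, E) x).symm) (extChartAt 𝓘(ℝ, E) x x) := by
    have h1 : fderivWithin ℝ (writtenInExtChartAt 𝓘(ℝ, E) 𝓘(ℝ, ℝ) x f) (Set.range 𝓘(ℝ, E))
        (extChartAt 𝓘(ℝ, E) x x) =
        fderiv ℝ (f ∘ (extChartAt 𝓘(ℝ, E) x).symm) (extChartAt 𝓘(ℝ, E) x x) := by
      rw [modelWithCornersSelf_coe, Set.range_id, fderivWithin_univ]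
      rfl
    exact hf.mfderiv.trans h1
  exact congrArg (fun A : E →L[ℝ] ℝ => A u) h

theorem smoothFieldAt_extend {x : M} (u : TangentSpace 𝓘(ℝ, E) x) :
    SmoothFieldAt (FiberBundle.extend E u) x :=
  FiberBundle.contMDiffAt_extend 𝓘(ℝ, E) E u

/-- The bundle extension is constant in the trivialization at `x`, which is the one induced by the
preferred chart. Such fields serve as test fields with constant coefficients. -/
theorem chartField_extend {x : M} (u : TangentSpace 𝓘(ℝ, E) x) {y : E}
    (hy : y ∈ (extChartAt 𝓘(ℝ, E) x).target) :
    chartField x (FiberBundle.extend E u) y = u := by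
  have : IsManifold 𝓘(ℝ, E) 1 M := .of_le (n := ∞) (by norm_cast)
  have hs : (extChartAt 𝓘(ℝ, E) x).symm y ∈ (chartAt E x).source := by
    rw [← extChartAt_source 𝓘(ℝ, E)]; exact (extChartAt 𝓘(ℝ, E) x).map_target hy
  have key : ∀ w : E,
      (trivializationAt E (TangentSpace 𝓘(ℝ, E)) x).symm ((extChartAt 𝓘(ℝ, E) x).symm y) w =
        chartDeriv x y w := by
    intro w
    have h := TangentBundle.symmL_trivializationAt (I := 𝓘(ℝ, E)) hs
    simp only [modelWithCornersSelf_coe, Set.range_id, mfderivWithin_univ] at h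
    rw [(extChartAt 𝓘(ℝ, E) x).right_inv hy] at h
    have h2 := congrArg (fun A : E →L[ℝ] E => A w) h
    exact (Trivialization.symmL_apply (R := ℝ)
      (trivializationAt E (TangentSpace 𝓘(ℝ, E)) x)
      (by rwa [TangentBundle.trivializationAt_baseSet]) w).symm.trans h2
  have hu : ((trivializationAt E (TangentSpace 𝓘(ℝ, E)) x) ⟨x, u⟩).2 = u := by
    have h := TangentBundle.continuousLinearMapAt_trivializationAt (I := 𝓘(ℝ, E))
      (mem_chart_source E x)
    rw [mfderiv_extChartAt_self] at h
    have h2 := congrArg (fun A : E →L[ℝ] E => A u) h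
    have h3 := Trivialization.continuousLinearMapAt_apply (R := ℝ)
      (trivializationAt E (TangentSpace 𝓘(ℝ, E)) x) x
    have h4 := congrFun h3 u
    rw [Trivialization.coe_linearMapAt_of_mem _ (FiberBundle.mem_baseSet_trivializationAt' x)] at h4
    exact h4.symm.trans h2
  apply chartDeriv_injective hy
  refine (chartDeriv_chartField _ hy).trans (Eq.trans ?_ (key u))
  exact congrArg
    ((trivializationAt E (TangentSpace 𝓘(ℝ, E)) x).symm ((extChartAt 𝓘(ℝ, E) x).symm y)) hu

end Chart

/-! ### The metric and the Levi-Civita connection in a chart -/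

section ChartMetric

theorem differentiableAt_of_apply {E F G : Type*} [NormedAddCommGroup E] [NormedSpace ℝ E]
    [NormedAddCommGroup F] [NormedSpace ℝ F] [FiniteDimensional ℝ F]
    [NormedAddCommGroup G] [NormedSpace ℝ G] {A : E → F →L[ℝ] G} {y : E}
    (h : ∀ v, DifferentiableAt ℝ (fun z => A z v) y) : DifferentiableAt ℝ A y := by
  let e₁ := ContinuousLinearEquiv.ofFinrankEq (𝕜 := ℝ) (E := F)
    (F := Fin (Module.finrank ℝ F) → ℝ) (by simp)
  let e₂ := (e₁.arrowCongr (1 : G ≃L[ℝ] G)).trans (ContinuousLinearEquiv.piRing (Fin _))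
  rw [← Function.id_comp A, ← e₂.symm_comp_self, Function.comp_assoc]
  refine e₂.symm.differentiable.differentiableAt.comp y (differentiableAt_pi.2 fun i => ?_)
  exact h _

variable {E : Type*} [NormedAddCommGroup E] [NormedSpace ℝ E]
  {M : Type*} [TopologicalSpace M] [ChartedSpace E M] [IsManifold 𝓘(ℝ, E) ∞ M]
  (g : ContMDiffRiemannianMetric 𝓘(ℝ, E) ∞ E (fun x : M => TangentSpace 𝓘(ℝ, E) x))

/-- The metric at `x` as a bilinear form on the model space. -/
def metricAt (x : M) : E →L[ℝ] E →L[ℝ] ℝ := g.inner x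

theorem metricAt_symm (x : M) (u v : E) : metricAt g x u v = metricAt g x v u :=
  g.symm x u v

theorem metricAt_pos (x : M) {u : E} (hu : u ≠ 0) : 0 < metricAt g x u u :=
  g.pos x u hu

theorem metricAt_nonneg (x : M) (u : E) : 0 ≤ metricAt g x u u := by
  by_cases hu : u = 0
  · simp [hu]
  · exact (metricAt_pos g x hu).le

theorem chartMetric_apply (x₀ : M) (y u v : E) :
    chartMetric g x₀ y u v = metricAt g ((extChartAt 𝓘(ℝ, E) x₀).symm y)
      (chartDeriv x₀ y u) (chartDeriv x₀ y v) := by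
  unfold chartMetric metricAt chartDeriv
  rfl

theorem chartMetric_symm (x₀ : M) (y u v : E) :
    chartMetric g x₀ y u v = chartMetric g x₀ y v u := by
  rw [chartMetric_apply, chartMetric_apply, metricAt_symm]

theorem chartMetric_chartField {x₀ : M} (X Y : (x : M) → TangentSpace 𝓘(ℝ, E) x) {y : E}
    (hy : y ∈ (extChartAt 𝓘(ℝ, E) x₀).target) :
    chartMetric g x₀ y (chartField x₀ X y) (chartField x₀ Y y) =
      metricAt g ((extChartAt 𝓘(ℝ, E) x₀).symm y) (valueAt X ((extChartAt 𝓘(ℝ, E) x₀).symm y))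
        (valueAt Y ((extChartAt 𝓘(ℝ, E) x₀).symm y)) := by
  rw [chartMetric_apply, chartDeriv_chartField X hy, chartDeriv_chartField Y hy]

theorem chartMetric_self (x : M) :
    chartMetric g x (extChartAt 𝓘(ℝ, E) x x) = metricAt g x := by
  ext u v
  rw [chartMetric_apply, chartDeriv_self, extChartAt_to_inv]
  rfl

theorem contMDiffAt_inner {X Y : (x : M) → TangentSpace 𝓘(ℝ, E) x} {x : M}
    (hX : SmoothFieldAt X x) (hY : SmoothFieldAt Y x) :
    ContMDiffAt 𝓘(ℝ, E) 𝓘(ℝ, ℝ) ∞ (fun y => metricAt g y (valueAt X y) (valueAt Y y)) x := by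
  have : ContMDiffAt 𝓘(ℝ, E) (𝓘(ℝ, E).prod 𝓘(ℝ, ℝ)) ∞
      (fun m ↦ TotalSpace.mk' ℝ (E := Bundle.Trivial M ℝ) m (g.inner m (X m) (Y m))) x := by
    apply ContMDiffAt.clm_bundle_apply₂ (F₁ := E) (F₂ := E)
    · exact g.contMDiff.contMDiffAt
    · exact hX
    · exact hY
  simp only [contMDiffAt_totalSpace] at this
  exact this.2

/-- A vector field extending the tangent vector `u` at `x`. -/
def extendField (x : M) (u : E) : (y : M) → TangentSpace 𝓘(ℝ, E) y :=
  FiberBundle.extend E (x := x) (u : TangentSpace 𝓘(ℝ, E) x)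

theorem extendField_self (x : M) (u : E) : valueAt (extendField x u) x = u :=
  FiberBundle.extend_apply_self (E := (TangentSpace 𝓘(ℝ, E) : M → Type _)) E (x := x) u

theorem smoothFieldAt_extendField (x : M) (u : E) : SmoothFieldAt (extendField x u) x :=
  smoothFieldAt_extend (x := x) u

theorem chartField_extendField (x : M) (u : E) {y : E}
    (hy : y ∈ (extChartAt 𝓘(ℝ, E) x).target) : chartField x (extendField x u) y = u :=
  chartField_extend (x := x) u hy

theorem differentiableAt_chartMetric [FiniteDimensional ℝ E] (x : M) :
    DifferentiableAt ℝ (chartMetric g x) (extChartAt 𝓘(ℝ, E) x x) := by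
  -- In finite dimension the coefficients suffice, and each is the inner product of two smooth
  -- fields with constant coordinates.
  refine differentiableAt_of_apply fun u => differentiableAt_of_apply fun v => ?_
  have h := (contMDiffAt_inner g (smoothFieldAt_extendField x u)
    (smoothFieldAt_extendField x v))
  rw [← extChartAt_to_inv (I := 𝓘(ℝ, E)) x] at h
  have h2 := (ContMDiffAt.comp (extChartAt 𝓘(ℝ, E) x x)
    (g := fun y => metricAt g y (valueAt (extendField x u) y) (valueAt (extendField x v) y)) (by simpa using h)
    (contMDiffAt_symm x (mem_extChartAt_target x))).contDiffAt.differentiableAt (by simp)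
  refine h2.congr_of_eventuallyEq ?_
  filter_upwards [eventually_mem_target x] with y hy
  have h3 := chartMetric_chartField g (extendField x u) (extendField x v) hy
  rwa [chartField_extendField _ _ hy, chartField_extendField _ _ hy] at h3

/-- The derivative of the metric in the preferred chart at `x`, at the centre of the chart. -/
def metricDeriv (x : M) (w u v : E) : ℝ :=
  fderiv ℝ (chartMetric g x) (extChartAt 𝓘(ℝ, E) x x) w u v

theorem fderiv_chartMetric_apply [FiniteDimensional ℝ E] (x : M) {X Y : E → E}
    (hX : DifferentiableAt ℝ X (extChartAt 𝓘(ℝ, E) x x))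
    (hY : DifferentiableAt ℝ Y (extChartAt 𝓘(ℝ, E) x x)) (w : E) :
    fderiv ℝ (fun y => chartMetric g x y (X y) (Y y)) (extChartAt 𝓘(ℝ, E) x x) w =
      metricDeriv g x w (X (extChartAt 𝓘(ℝ, E) x x)) (Y (extChartAt 𝓘(ℝ, E) x x)) +
      metricAt g x (fderiv ℝ X (extChartAt 𝓘(ℝ, E) x x) w) (Y (extChartAt 𝓘(ℝ, E) x x)) +
      metricAt g x (X (extChartAt 𝓘(ℝ, E) x x)) (fderiv ℝ Y (extChartAt 𝓘(ℝ, E) x x) w) := by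
  have h := (differentiableAt_chartMetric g x)
  rw [((h.hasFDerivAt.clm_apply hX.hasFDerivAt).clm_apply hY.hasFDerivAt).fderiv, ← chartMetric_self]
  simp [metricDeriv]
  ring

theorem metricDeriv_symm [FiniteDimensional ℝ E] (x : M) (w u v : E) :
    metricDeriv g x w u v = metricDeriv g x w v u := by
  have h1 := fderiv_chartMetric_apply g x (differentiableAt_const u) (differentiableAt_const v) w
  have h2 := fderiv_chartMetric_apply g x (differentiableAt_const v) (differentiableAt_const u) w
  simp only [chartMetric_symm g x _ u v] at h1
  simp only [fderiv_fun_const, Pi.zero_apply, zero_apply, map_zero,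
    add_zero] at h1 h2
  exact h1.symm.trans h2

/-- The musical isomorphism at `x` on the model space. -/
def sharpAt (x : M) : (E →L[ℝ] ℝ) →L[ℝ] E := sharp g x

theorem metricAt_sharp [FiniteDimensional ℝ E] (x : M) (α : E →L[ℝ] ℝ) (v : E) :
    metricAt g x (sharpAt g x α) v = α v :=
  inner_sharp g x α v

/-- The Levi-Civita covariant derivative at `x`, as an endomorphism of the model space. -/
def nablaAt (X : (x : M) → TangentSpace 𝓘(ℝ, E) x) (x : M) : E →L[ℝ] E := nabla g X x

/-- Pairing with `w` cancels the musical isomorphism and leaves Christoffel symbols of the first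
kind. Every later identity for `∇` is checked through this formula. -/
theorem metricAt_nablaAt [FiniteDimensional ℝ E] (X : (x : M) → TangentSpace 𝓘(ℝ, E) x) (x : M)
    (u w : E) :
    metricAt g x (nablaAt g X x u) w =
      metricAt g x (fderiv ℝ (chartField x X) (extChartAt 𝓘(ℝ, E) x x) u) w +
      1 / 2 * (metricDeriv g x u (valueAt X x) w + metricDeriv g x (valueAt X x) u w
        - metricDeriv g x w (valueAt X x) u) := by
  have h1 : nablaAt g X x u = fderiv ℝ (chartField x X) (extChartAt 𝓘(ℝ, E) x x) u +
      sharpAt g x (christoffel g x (valueAt X x) u) := rfl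
  rw [h1, map_add, add_apply, metricAt_sharp]
  rfl

end ChartMetric

/-! ### Killing fields from holomorphic gradients -/

section Killing

variable {E : Type*} [NormedAddCommGroup E] [NormedSpace ℝ E] [FiniteDimensional ℝ E]
  {M : Type*} [TopologicalSpace M] [ChartedSpace E M] [IsManifold 𝓘(ℝ, E) ∞ M]
  (g : ContMDiffRiemannianMetric 𝓘(ℝ, E) ∞ E (fun x : M => TangentSpace 𝓘(ℝ, E) x))

omit [FiniteDimensional ℝ E] in
theorem metricAt_ext (x : M) {u v : E} (h : ∀ w, metricAt g x u w = metricAt g x v w) :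
    u = v := by
  by_contra hne
  have h1 := metricAt_pos g x (sub_ne_zero.2 hne)
  rw [map_sub (metricAt g x), sub_apply, h, sub_self] at h1
  exact lt_irrefl _ h1

theorem metricAt_grad (f : M → ℝ) (x : M) (w : E) :
    metricAt g x (valueAt (grad g f) x) w = diffAt f x w :=
  inner_sharp g x _ w

theorem chartMetric_grad {f : M → ℝ} (hf : ContMDiff 𝓘(ℝ, E) 𝓘(ℝ, ℝ) ∞ f) {x : M} {y : E}
    (hy : y ∈ (extChartAt 𝓘(ℝ, E) x).target) (w : E) :
    chartMetric g x y (chartField x (grad g f) y) w =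
      fderiv ℝ (f ∘ (extChartAt 𝓘(ℝ, E) x).symm) y w := by
  rw [chartMetric_apply, chartDeriv_chartField _ hy, metricAt_grad, fderiv_comp_symm hf hy]

/-- The Hessian of a function is symmetric. -/
theorem metricAt_nabla_grad_comm {f : M → ℝ} (hf : ContMDiff 𝓘(ℝ, E) 𝓘(ℝ, ℝ) ∞ f) {x : M}
    (hs : SmoothFieldAt (grad g f) x) (u v : E) :
    metricAt g x (nablaAt g (grad g f) x u) v = metricAt g x (nablaAt g (grad g f) x v) u := by
  have hsymm : IsSymmSndFDerivAt ℝ (f ∘ (extChartAt 𝓘(ℝ, E) x).symm)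
      (extChartAt 𝓘(ℝ, E) x x) :=
    (contDiffAt_comp_symm hf (mem_extChartAt_target x)).isSymmSndFDerivAt (by simp; norm_cast)
  have hdf : DifferentiableAt ℝ (fderiv ℝ (f ∘ (extChartAt 𝓘(ℝ, E) x).symm))
      (extChartAt 𝓘(ℝ, E) x x) :=
    ((contDiffAt_comp_symm hf (mem_extChartAt_target x)).fderiv_right (m := 1)
      (by norm_cast)).differentiableAt (by simp)
  -- Differentiate `g(grad f, w) = df(w)` with `w` constant; the left side is the symmetric second
  -- derivative of `f` in the chart. The Christoffel terms turn the remaining metric derivatives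
  -- into an expression symmetric in the two directions.
  have key : ∀ u w : E,
      fderiv ℝ (fderiv ℝ (f ∘ (extChartAt 𝓘(ℝ, E) x).symm)) (extChartAt 𝓘(ℝ, E) x x) u w =
        metricDeriv g x u (valueAt (grad g f) x) w +
        metricAt g x (fderiv ℝ (chartField x (grad g f)) (extChartAt 𝓘(ℝ, E) x x) u) w := by
    intro u w
    have h1 := fderiv_chartMetric_apply g x hs.differentiableAt (differentiableAt_const w) u
    have h2 : (fun y => chartMetric g x y (chartField x (grad g f) y) w) =ᶠ[
        𝓝 (extChartAt 𝓘(ℝ, E) x x)]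
        fun y => fderiv ℝ (f ∘ (extChartAt 𝓘(ℝ, E) x).symm) y w := by
      filter_upwards [eventually_mem_target x] with y hy using chartMetric_grad g hf hy w
    rw [h2.fderiv_eq, (hdf.hasFDerivAt.clm_apply (hasFDerivAt_const w _)).fderiv,
      chartField_self] at h1
    simpa using h1
  have hu := key u v
  have hv := key v u
  rw [hsymm u v] at hu
  have := metricDeriv_symm g x (valueAt (grad g f) x) u v
  rw [metricAt_nablaAt, metricAt_nablaAt]
  linarith

/-- The Levi-Civita connection is torsion free. -/
theorem bracketAt_eq_nablaAt (V W : (x : M) → TangentSpace 𝓘(ℝ, E) x) (x : M) :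
    bracketAt V W x = nablaAt g W x (valueAt V x) - nablaAt g V x (valueAt W x) := by
  apply metricAt_ext g x
  intro w
  rw [bracketAt_eq, map_sub, map_sub, sub_apply, sub_apply, metricAt_nablaAt, metricAt_nablaAt,
    metricDeriv_symm g x w (valueAt V x) (valueAt W x)]
  ring

theorem diffAt_metricAt {X Y : (x : M) → TangentSpace 𝓘(ℝ, E) x} {x : M}
    (hX : SmoothFieldAt X x) (hY : SmoothFieldAt Y x) (w : E) :
    diffAt (fun y => metricAt g y (valueAt X y) (valueAt Y y)) x w =
      metricDeriv g x w (valueAt X x) (valueAt Y x) +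
      metricAt g x (fderiv ℝ (chartField x X) (extChartAt 𝓘(ℝ, E) x x) w) (valueAt Y x) +
      metricAt g x (valueAt X x) (fderiv ℝ (chartField x Y) (extChartAt 𝓘(ℝ, E) x x) w) := by
  have h1 := fderiv_chartMetric_apply g x hX.differentiableAt hY.differentiableAt w
  rw [chartField_self, chartField_self] at h1
  rw [← h1, diffAt_eq_fderiv ((contMDiffAt_inner g hX hY).mdifferentiableAt (by simp))]
  refine congrArg (fun A : E →L[ℝ] ℝ => A w) (Filter.EventuallyEq.fderiv_eq ?_)
  filter_upwards [eventually_mem_target x] with y hy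
  exact (chartMetric_chartField g X Y hy).symm

/-- A smooth vector field whose covariant derivative is skew-symmetric is a Killing field. -/
theorem isKillingField_of_skew {W : (x : M) → TangentSpace 𝓘(ℝ, E) x}
    (hW : ∀ x, SmoothFieldAt W x)
    (hskew : ∀ x u v, metricAt g x (nablaAt g W x u) v + metricAt g x (nablaAt g W x v) u = 0) :
    IsKillingField g W := by
  refine ⟨hW, fun x X Y hX hY => ?_⟩
  have h1 := diffAt_metricAt g hX hY (valueAt W x)
  have h2 := hskew x (valueAt X x) (valueAt Y x)
  rw [metricAt_nablaAt, metricAt_nablaAt] at h2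
  have h3 : diffAt (fun y => metricAt g y (valueAt X y) (valueAt Y y)) x (valueAt W x) =
      metricAt g x (bracketAt W X x) (valueAt Y x) +
      metricAt g x (valueAt X x) (bracketAt W Y x) := by
    -- The derivatives of `X` and `Y` cancel; what remains is skewness of `∇W`, whose Christoffel
    -- terms sum to the derivative of the metric along `W`.
    rw [bracketAt_eq, bracketAt_eq, h1, map_sub, map_sub, sub_apply,
      metricAt_symm g x (valueAt X x) (fderiv ℝ (chartField x W) _ _)]
    have := metricDeriv_symm g x (valueAt W x) (valueAt X x) (valueAt Y x)
    have := metricDeriv_symm g x (valueAt X x) (valueAt W x) (valueAt Y x)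
    have := metricDeriv_symm g x (valueAt Y x) (valueAt W x) (valueAt X x)
    linarith
  exact h3

omit [FiniteDimensional ℝ E] in
theorem SmoothEndField.smoothFieldAt
    {J : (x : M) → TangentSpace 𝓘(ℝ, E) x →L[ℝ] TangentSpace 𝓘(ℝ, E) x}
    (hJ : SmoothEndField J) {X : (x : M) → TangentSpace 𝓘(ℝ, E) x} {x : M}
    (hX : SmoothFieldAt X x) : SmoothFieldAt (fun y => J y (X y)) x := by
  apply ContMDiffAt.clm_bundle_apply (F₁ := E) (F₂ := E)
  · exact hJ.contMDiffAt
  · exact hX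

/-- The endomorphism `J` at `x`, on the model space. -/
def endAt (J : (x : M) → TangentSpace 𝓘(ℝ, E) x →L[ℝ] TangentSpace 𝓘(ℝ, E) x) (x : M) :
    E →L[ℝ] E := J x

section Kahler

variable {g} {J : (x : M) → TangentSpace 𝓘(ℝ, E) x →L[ℝ] TangentSpace 𝓘(ℝ, E) x}
  (hJ : IsKahler g J)
include hJ

-- An isometry with square `-1` has inverse `-J`, which is also its adjoint.
omit [FiniteDimensional ℝ E] in
theorem IsKahler.endAt_skew (x : M) (u v : E) :
    metricAt g x (endAt J x u) v = -metricAt g x (endAt J x v) u := by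
  have h1 : metricAt g x (endAt J x u) (endAt J x (endAt J x v)) =
      metricAt g x u (endAt J x v) := hJ.hermitian x u _
  have h2 : endAt J x (endAt J x v) = -v := hJ.sq x v
  rw [h2, map_neg, metricAt_symm g x u] at h1
  linarith

omit [FiniteDimensional ℝ E] in
/-- On a Kähler manifold, `J` is parallel. -/
theorem IsKahler.nablaAt_end {X : (x : M) → TangentSpace 𝓘(ℝ, E) x} {x : M}
    (hX : SmoothFieldAt X x) (u : E) :
    nablaAt g (fun y => J y (X y)) x u = endAt J x (nablaAt g X x u) :=
  hJ.parallel x X hX u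

/-- On a Kähler manifold, the covariant derivative of a holomorphic field commutes with `J`. -/
theorem IsKahler.nablaAt_comm {V : (x : M) → TangentSpace 𝓘(ℝ, E) x}
    (hV : IsHolomorphicField J V) (x : M) (u : E) :
    nablaAt g V x (endAt J x u) = endAt J x (nablaAt g V x u) := by
  have hX := smoothFieldAt_extendField x u
  have h1 : bracketAt V (fun y => J y (extendField x u y)) x =
      endAt J x (bracketAt V (extendField x u) x) := hV.2 x _ hX
  have h2 : valueAt (fun y => J y (extendField x u y)) x =
      endAt J x (valueAt (extendField x u) x) := rfl
  -- Expanding both brackets without torsion, the terms `J ∇_V X` agree because `J` is parallel,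
  -- leaving `∇_{JX} V = J ∇_X V`.
  rw [bracketAt_eq_nablaAt g, bracketAt_eq_nablaAt g, hJ.nablaAt_end hX, h2, extendField_self,
    map_sub] at h1
  exact sub_right_injective h1

/-- On a Kähler manifold, `J (grad f)` is a Killing field for every function `f` with
holomorphic gradient. -/
theorem IsKahler.isKillingField_grad {f : M → ℝ} (hf : ContMDiff 𝓘(ℝ, E) 𝓘(ℝ, ℝ) ∞ f)
    (hV : IsHolomorphicField J (grad g f)) :
    IsKillingField g (fun x => J x (grad g f x)) := by
  refine isKillingField_of_skew g (fun x => hJ.smooth.smoothFieldAt (hV.1 x)) fun x u v => ?_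
  -- `g(J∇_u V, v) = -g(∇_u V, Jv) = -g(∇_{Jv} V, u) = -g(J∇_v V, u)`.
  rw [hJ.nablaAt_end (hV.1 x), hJ.nablaAt_end (hV.1 x), hJ.endAt_skew,
    metricAt_symm g x (endAt J x v), metricAt_nabla_grad_comm g hf (hV.1 x),
    hJ.nablaAt_comm hV, neg_add_cancel]

end Kahler

end Killing

/-! ### Derivatives of determinants -/

section Determinants

variable {n : Type*} [Fintype n] [DecidableEq n]

/-- Jacobi's formula for the derivative of the determinant at the identity matrix. -/
theorem hasDerivAt_det_of_eq_one {A : ℝ → Matrix n n ℝ} {A' : Matrix n n ℝ} {t : ℝ}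
    (hA : ∀ i j, HasDerivAt (fun s => A s i j) (A' i j) t) (h1 : A t = 1) :
    HasDerivAt (fun s => (A s).det) A'.trace t := by
  let D : ContinuousMultilinearMap ℝ (fun _ : n => n → ℝ) ℝ :=
    { (Matrix.detRowAlternating (n := n) (R := ℝ)).toMultilinearMap with
      cont := Continuous.matrix_det continuous_id }
  have hA' : HasDerivAt (fun s => (A s : n → n → ℝ)) A' t :=
    hasDerivAt_pi.2 fun i => hasDerivAt_pi.2 fun j => hA i j
  have h := (D.hasFDerivAt (A t)).comp_hasDerivAt t hA'
  -- The derivative of a multilinear map replaces one row at a time; in the identity matrix, the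
  -- `i`-th replacement has determinant `A' i i`.
  have htr : D.linearDeriv (A t) A' = A'.trace := by
    refine (D.linearDeriv_apply (A t) A').trans ?_
    refine Finset.sum_congr rfl fun i _ => ?_
    have h2 : D (Function.update (A t) i (A' i)) = (Matrix.updateRow (A t) i (A' i)).det := rfl
    rw [h2, h1, ← Matrix.det_transpose, ← Matrix.updateCol_transpose, Matrix.transpose_one,
      ← Matrix.cramer_apply, Matrix.cramer_one]
    rfl
  rw [← htr]
  exact h

/-- Jacobi's formula for the derivative of the determinant at an invertible matrix. -/
theorem hasDerivAt_det {A : ℝ → Matrix n n ℝ} {A' : Matrix n n ℝ} {t : ℝ}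
    (hA : ∀ i j, HasDerivAt (fun s => A s i j) (A' i j) t) (h0 : IsUnit (A t).det) :
    HasDerivAt (fun s => (A s).det) ((A t).det * ((A t)⁻¹ * A').trace) t := by
  have h1 : ∀ i j, HasDerivAt (fun s => ((A t)⁻¹ * A s) i j) (((A t)⁻¹ * A') i j) t := by
    intro i j
    simp only [Matrix.mul_apply]
    exact HasDerivAt.fun_sum fun k _ => (hA k j).const_mul _
  have h2 := (hasDerivAt_det_of_eq_one h1 (Matrix.nonsing_inv_mul _ h0)).const_mul (A t).det
  refine h2.congr_of_eventuallyEq (.of_forall fun s => ?_)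
  simp only [← Matrix.det_mul, Matrix.mul_nonsing_inv_cancel_left _ _ h0]

/-- A curve of bilinear forms that is infinitesimally transported by an endomorphism `B`. -/
theorem hasDerivAt_det_of_transport {A : ℝ → Matrix n n ℝ} {B : Matrix n n ℝ} {t : ℝ}
    (hA : ∀ i j, HasDerivAt (fun s => A s i j) ((-(B.transpose * A t + A t * B)) i j) t)
    (h0 : IsUnit (A t).det) :
    HasDerivAt (fun s => (A s).det) (-2 * B.trace * (A t).det) t := by
  have h := hasDerivAt_det hA h0
  have htr : ((A t)⁻¹ * (-(B.transpose * A t + A t * B))).trace = -2 * B.trace := by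
    rw [mul_neg, Matrix.trace_neg, mul_add, Matrix.trace_add, ← mul_assoc, ← mul_assoc,
      Matrix.nonsing_inv_mul _ h0, one_mul, Matrix.trace_mul_cycle, Matrix.mul_nonsing_inv _ h0,
      one_mul, Matrix.trace_transpose]
    ring
  rw [htr, mul_comm] at h
  exact h

end Determinants

/-! ### Orthonormal frames and traces -/

section Frames

variable {E : Type*} [NormedAddCommGroup E] [NormedSpace ℝ E] {ι : Type*} [Fintype ι]
  [DecidableEq ι]

/-- `f` is an orthonormal frame for the bilinear form `G`. -/
structure IsOrthonormalFrame (G : E →L[ℝ] E →L[ℝ] ℝ) (f : ι → E) : Prop where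
  apply_eq (a c : ι) : G (f a) (f c) = if a = c then 1 else 0
  span : Submodule.span ℝ (Set.range f) = ⊤

variable {G : E →L[ℝ] E →L[ℝ] ℝ} {f : ι → E} (hf : IsOrthonormalFrame G f)
include hf

theorem IsOrthonormalFrame.expansion (X : E) : X = ∑ a, G (f a) X • f a := by
  have h : (LinearMap.id : E →ₗ[ℝ] E) =
      ∑ a, (G (f a)).toLinearMap.smulRight (f a) := by
    refine LinearMap.ext_on_range hf.span fun c => ?_
    simp [hf.apply_eq, LinearMap.sum_apply]
  simpa [LinearMap.sum_apply] using congrArg (fun L : E →ₗ[ℝ] E => L X) h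

theorem IsOrthonormalFrame.trace_eq (A : E →L[ℝ] E) :
    LinearMap.trace ℝ E A.toLinearMap = ∑ a, G (f a) (A (f a)) := by
  have hli : LinearIndependent ℝ f := by
    rw [Fintype.linearIndependent_iff]
    intro c hc i
    have := congrArg (G (f i)) hc
    simpa [map_sum, hf.apply_eq] using this
  let b := Module.Basis.mk hli hf.span.ge
  have hb : ∀ a, b a = f a := fun a => by simp [b]
  have hr : ∀ X a, b.repr X a = G (f a) X := by
    intro X a
    conv_lhs => rw [hf.expansion X]
    simp only [← hb, map_sum, map_smul, Module.Basis.repr_self]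
    simp [Finsupp.single_apply]
  rw [LinearMap.trace_eq_matrix_trace ℝ b, Matrix.trace]
  refine Finset.sum_congr rfl fun a _ => ?_
  simp [LinearMap.toMatrix_apply, hr, hb]

end Frames

/-! ### The Gram determinant of a degenerate form completed by a covector -/

section Gram

variable {E : Type*} [NormedAddCommGroup E] [NormedSpace ℝ E] {k : ℕ}

/-- Determinant of a bilinear form of corank one that is diagonal in a `G`-orthonormal frame,
completed by the square of a linear form. -/
theorem IsOrthonormalFrame.det_add_sq {G P : E →L[ℝ] E →L[ℝ] ℝ} {f : Fin k ⊕ Unit → E}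
    (hf : IsOrthonormalFrame G f) {lam : Fin k → ℝ}
    (hP : ∀ i X, P (f (.inl i)) X = lam i ^ 2 * G (f (.inl i)) X)
    (hP' : ∀ X, P (f (.inr ())) X = 0) (θ : E →L[ℝ] ℝ) (b : Fin k ⊕ Unit → E) :
    (Matrix.of fun i j => P (b i) (b j) + θ (b i) * θ (b j)).det =
      (∏ i, lam i) ^ 2 * θ (f (.inr ())) ^ 2 * (Matrix.of fun i j => G (b i) (b j)).det := by
  let C : Matrix (Fin k ⊕ Unit) (Fin k ⊕ Unit) ℝ := Matrix.of fun a j => G (f a) (b j)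
  -- The rows of `K` are the covectors `lam i • G (f (inl i))` and `θ` in the frame, so `Kᵀ K`
  -- represents `P + θ⊗θ`. It is block triangular, hence only the value of `θ` on the kernel
  -- direction enters its determinant.
  let K : Matrix (Fin k ⊕ Unit) (Fin k ⊕ Unit) ℝ :=
    Matrix.fromBlocks (Matrix.diagonal lam) 0 (Matrix.of fun _ i => θ (f (.inl i)))
      (Matrix.of fun _ _ => θ (f (.inr ())))
  have hG : (Matrix.of fun i j => G (b i) (b j)) = C.transpose * C := by
    ext i j
    conv_lhs => rw [Matrix.of_apply, hf.expansion (b i)]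
    simp [C, Matrix.mul_apply]
  have hKl : ∀ i j, (K * C) (.inl i) j = lam i * G (f (.inl i)) (b j) := by
    intro i j
    simp [K, C, Matrix.mul_apply, Matrix.diagonal_apply]
  have hKr : ∀ j, (K * C) (.inr ()) j = θ (b j) := by
    intro j
    conv_rhs => rw [hf.expansion (b j)]
    simp [K, C, Matrix.mul_apply, mul_comm]
  have hT : (Matrix.of fun i j => P (b i) (b j) + θ (b i) * θ (b j)) =
      (K * C).transpose * (K * C) := by
    ext i j
    have h1 : P (b i) = ∑ a, G (f a) (b i) • P (f a) := by
      conv_lhs => rw [hf.expansion (b i)]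
      rw [map_sum]
      simp only [map_smul]
    rw [Matrix.mul_apply, Fintype.sum_sum_type, Matrix.of_apply, h1, Fintype.sum_sum_type]
    simp [Matrix.transpose_apply, hKl, hKr, hP, hP', add_apply, sum_apply, smul_apply]
    exact Finset.sum_congr rfl fun i _ => by ring
  have hK : K.det = (∏ i, lam i) * θ (f (.inr ())) := by
    simp [K, Matrix.det_fromBlocks_zero₁₂]
  rw [hT, hG, Matrix.det_mul, Matrix.det_transpose, Matrix.det_mul, Matrix.det_mul,
    Matrix.det_transpose, hK]
  ring

end Gram

/-! ### The divergence formula in a vector space -/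

section Euclidean

theorem hasDerivAt_comp_line {E F : Type*} [NormedAddCommGroup E] [NormedSpace ℝ E]
    [NormedAddCommGroup F] [NormedSpace ℝ F] {Φ : E → F} {y : E}
    (hΦ : DifferentiableAt ℝ Φ y) (v : E) :
    HasDerivAt (fun t : ℝ => Φ (y + t • v)) (fderiv ℝ Φ y v) 0 := by
  have h1 : HasDerivAt (fun t : ℝ => y + t • v) v 0 := by
    simpa using ((hasDerivAt_id (0 : ℝ)).smul_const v).const_add y
  exact HasFDerivAt.comp_hasDerivAt (0 : ℝ) (f := fun t : ℝ => y + t • v)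
    (by simpa using hΦ.hasFDerivAt) h1

variable {E : Type*} [NormedAddCommGroup E] [NormedSpace ℝ E]
  {E' : Type*} [NormedAddCommGroup E'] [NormedSpace ℝ E']
  {ι : Type*} [Fintype ι] [DecidableEq ι]

/-- The pullback of a bilinear form under a linear map. -/
def pullbackForm (H : E' →L[ℝ] E' →L[ℝ] ℝ) (A : E →L[ℝ] E') : E →L[ℝ] E →L[ℝ] ℝ :=
  H.bilinearComp A A

/-- If `φ_* V = 0`, the pullback by `φ` of a field of bilinear forms is transported by `V`. -/
theorem hasDerivAt_pullbackForm {H : E' → E' →L[ℝ] E' →L[ℝ] ℝ} {φ : E → E'} {V : E → E} {y : E}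
    (hH : DifferentiableAt ℝ H (φ y)) (hφ : ContDiffAt ℝ 2 φ y) (hV : DifferentiableAt ℝ V y)
    (hker : ∀ᶠ z in 𝓝 y, fderiv ℝ φ z (V z) = 0) (u w : E) :
    HasDerivAt (fun t : ℝ => pullbackForm (H (φ (y + t • V y))) (fderiv ℝ φ (y + t • V y)) u w)
      (-(pullbackForm (H (φ y)) (fderiv ℝ φ y) (fderiv ℝ V y u) w +
        pullbackForm (H (φ y)) (fderiv ℝ φ y) u (fderiv ℝ V y w))) 0 := by
  have hφd : DifferentiableAt ℝ φ y := hφ.differentiableAt (by simp)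
  have hdφ : DifferentiableAt ℝ (fderiv ℝ φ) y :=
    (hφ.fderiv_right (m := 1) (by norm_num)).differentiableAt (by simp)
  have hsymm : IsSymmSndFDerivAt ℝ φ y := hφ.isSymmSndFDerivAt (by simp)
  -- Differentiate `dφ(V) = 0` in direction `v` and swap the arguments of the second derivative.
  have hD : ∀ v, fderiv ℝ (fderiv ℝ φ) y (V y) v = -fderiv ℝ φ y (fderiv ℝ V y v) := by
    intro v
    have h0 : fderiv ℝ (fun z => fderiv ℝ φ z (V z)) y = 0 := by
      have := Filter.EventuallyEq.fderiv_eq (𝕜 := ℝ) (f₁ := fun z => fderiv ℝ φ z (V z))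
        (f := fun _ => 0) hker
      simpa using this
    rw [(hdφ.hasFDerivAt.clm_apply hV.hasFDerivAt).fderiv] at h0
    have h1 := congrArg (fun L : E →L[ℝ] E' => L v) h0
    simp only [add_apply, ContinuousLinearMap.comp_apply, ContinuousLinearMap.flip_apply,
      zero_apply] at h1
    rw [hsymm (V y) v]
    exact eq_neg_of_add_eq_zero_right h1
  have hker0 : fderiv ℝ φ y (V y) = 0 := hker.self_of_nhds
  have h1 := HasFDerivAt.comp (G := E' →L[ℝ] E' →L[ℝ] ℝ) y hH.hasFDerivAt hφd.hasFDerivAt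
  have h2 := (h1.clm_apply (hdφ.hasFDerivAt.clm_apply (hasFDerivAt_const u y))).clm_apply
    (hdφ.hasFDerivAt.clm_apply (hasFDerivAt_const w y))
  refine (hasDerivAt_comp_line h2.differentiableAt (V y)).congr_deriv ?_
  rw [h2.fderiv]
  have h3 : (fderiv ℝ H (φ y) ∘L fderiv ℝ φ y) (V y) = 0 := by
    rw [ContinuousLinearMap.comp_apply, hker0]
    exact (fderiv ℝ H (φ y)).map_zero
  simp only [add_apply, ContinuousLinearMap.comp_apply, ContinuousLinearMap.flip_apply] at h3 ⊢
  rw [h3]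
  simp only [zero_apply, hD, pullbackForm, ContinuousLinearMap.bilinearComp_apply, neg_add_rev,
    Function.comp_apply]
  have h4 : ∀ a b, H (φ y) (-a) b = -H (φ y) a b := fun a b => by
    rw [(H (φ y)).map_neg]
    rfl
  rw [(fderiv ℝ φ y).map_zero, zero_add, zero_add, add_zero, h4,
    (H (φ y) (fderiv ℝ φ y u)).map_neg]

/-- Liouville-type formula: if `φ_* V = 0` and the determinant of the pullback by `φ` of a metric,
completed by the square of a linear form `θ`, equals `R θ(V)²` times that of the metric `G`, then
`div V` is given by the logarithmic derivative of `R` along `V`. -/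
theorem divergence_formula {G : E → E →L[ℝ] E →L[ℝ] ℝ} {H : E' → E' →L[ℝ] E' →L[ℝ] ℝ}
    {φ : E → E'} {V : E → E} {R : E → ℝ} {y : E}
    (hG : ∀ u v, DifferentiableAt ℝ (fun z => G z u v) y)
    (hH : DifferentiableAt ℝ H (φ y)) (hφ : ContDiffAt ℝ 2 φ y) (hV : DifferentiableAt ℝ V y)
    (hR : DifferentiableAt ℝ R y) (hR0 : R y ≠ 0) (hVV : G y (V y) (V y) ≠ 0)
    (hker : ∀ᶠ z in 𝓝 y, fderiv ℝ φ z (V z) = 0)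
    (hdet : ∀ᶠ z in 𝓝 y, ∀ (θ : E →L[ℝ] ℝ) (b : ι → E),
      (Matrix.of fun i j => pullbackForm (H (φ z)) (fderiv ℝ φ z) (b i) (b j)
        + θ (b i) * θ (b j)).det =
        R z * θ (V z) ^ 2 * (Matrix.of fun i j => G z (b i) (b j)).det)
    {f : ι → E} (hf : IsOrthonormalFrame (G y) f) :
    (∑ a, G y (f a) (fderiv ℝ V y (f a))) + 1 / 2 * (∑ a, fderiv ℝ (fun z => G z (f a) (f a)) y (V y)) +
      1 / 2 * (fderiv ℝ R y (V y) / R y) = 0 := by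
  -- The covector dual to `V y`, corrected to first order so that its Lie derivative along `V`
  -- vanishes. Then `θ⊗θ` obeys the same transport law as the pullback, and `θ(V)` is stationary at
  -- `t = 0`.
  let θ : ℝ → E →L[ℝ] ℝ := fun t => G y (V y) - t • (G y (V y) ∘L fderiv ℝ V y)
  have hθ0 : θ 0 = G y (V y) := by simp [θ]
  have hθ : HasDerivAt θ (-(G y (V y) ∘L fderiv ℝ V y)) 0 := by
    simpa using ((hasDerivAt_id (0 : ℝ)).smul_const (G y (V y) ∘L fderiv ℝ V y)).const_sub
      (G y (V y))
  have hθv : ∀ v, HasDerivAt (fun t => θ t v) (-(G y (V y) (fderiv ℝ V y v))) 0 := by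
    intro v
    simpa using hθ.clm_apply (hasDerivAt_const (0 : ℝ) v)
  let T : ℝ → Matrix ι ι ℝ := fun t => Matrix.of fun i j =>
    pullbackForm (H (φ (y + t • V y))) (fderiv ℝ φ (y + t • V y)) (f i) (f j)
      + θ t (f i) * θ t (f j)
  -- The vectors `f` stay fixed along the line and are orthonormal only at `t = 0`, so the
  -- determinant of `g` varies at the rate of the trace of the metric derivative.
  let g : ℝ → Matrix ι ι ℝ := fun t => Matrix.of fun i j => G (y + t • V y) (f i) (f j)
  let B : Matrix ι ι ℝ := Matrix.of fun a i => G y (f a) (fderiv ℝ V y (f i))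
  have hB : ∀ i, fderiv ℝ V y (f i) = ∑ a, B a i • f a := fun i => hf.expansion _
  have hev : ∀ᶠ t in 𝓝 (0 : ℝ),
      (T t).det = R (y + t • V y) * θ t (V (y + t • V y)) ^ 2 * (g t).det := by
    have hc : Filter.Tendsto (fun t : ℝ => y + t • V y) (𝓝 0) (𝓝 y) := by
      have : Continuous fun t : ℝ => y + t • V y := by fun_prop
      simpa using this.tendsto 0
    filter_upwards [hc.eventually hdet] with t ht using ht (θ t) f
  have hg0 : g 0 = 1 := by
    ext i j
    simp [g, hf.apply_eq, Matrix.one_apply]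
  have hgd : HasDerivAt (fun t => (g t).det) (∑ a, fderiv ℝ (fun z => G z (f a) (f a)) y (V y)) 0 := by
    refine hasDerivAt_det_of_eq_one (A' := Matrix.of fun i j => fderiv ℝ (fun z => G z (f i) (f j)) y (V y))
      (fun i j => ?_) hg0
    exact hasDerivAt_comp_line (hG (f i) (f j)) (V y)
  have hRd := hasDerivAt_comp_line hR (V y)
  have hθV : HasDerivAt (fun t => θ t (V (y + t • V y))) 0 0 := by
    refine (hθ.clm_apply (hasDerivAt_comp_line hV (V y))).congr_deriv ?_
    simp [hθ0]
  have hT0 : (T 0).det = R y * G y (V y) (V y) ^ 2 := by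
    have := hev.self_of_nhds
    rw [hg0] at this
    simpa [hθ0] using this
  have hT0' : (T 0).det ≠ 0 := hT0 ▸ mul_ne_zero hR0 (pow_ne_zero 2 hVV)
  have hTd : HasDerivAt (fun t => (T t).det) (-2 * B.trace * (T 0).det) 0 := by
    refine hasDerivAt_det_of_transport (fun i j => ?_) (isUnit_iff_ne_zero.2 hT0')
    have h := (hasDerivAt_pullbackForm hH hφ hV hker (f i) (f j)).add
      ((hθv (f i)).mul (hθv (f j)))
    refine h.congr_deriv ?_
    rw [hB i, hB j]
    simp only [Matrix.neg_apply, Matrix.add_apply, Matrix.mul_apply, Matrix.transpose_apply, T,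
      Matrix.of_apply, zero_smul, add_zero, hθ0, map_sum, map_smul, sum_apply, smul_apply,
      smul_eq_mul, mul_add, add_mul, Finset.sum_add_distrib]
    simp only [Finset.mul_sum, mul_neg, mul_comm]
    simp only [mul_assoc]
    ring
  have hmain := ((hRd.mul (hθV.pow 2)).mul hgd).congr_of_eventuallyEq hev
  -- Two computations of one derivative: by transport, and from the product `R θ(V)² det g`.
  have heq := hTd.unique hmain
  have htr : B.trace = ∑ a, G y (f a) (fderiv ℝ V y (f a)) := rfl
  rw [← htr]
  rw [hT0, hg0] at heq
  simp only [Matrix.det_one, zero_smul, add_zero, hθ0, Pi.pow_apply, Pi.mul_apply, mul_zero,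
    mul_one] at heq
  have hp : G y (V y) (V y) ^ 2 ≠ 0 := pow_ne_zero 2 hVV
  field_simp
  apply mul_left_cancel₀ hp
  linarith

end Euclidean

/-! ### Maps between manifolds read in charts -/

section Submersion

variable {E : Type*} [NormedAddCommGroup E] [NormedSpace ℝ E]
  {M : Type*} [TopologicalSpace M] [ChartedSpace E M] [IsManifold 𝓘(ℝ, E) ∞ M]
  {E' : Type*} [NormedAddCommGroup E'] [NormedSpace ℝ E']
  {N : Type*} [TopologicalSpace N] [ChartedSpace E' N] [IsManifold 𝓘(ℝ, E') ∞ N]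

variable (E E') in
/-- The differential of a map, as a linear map between the model spaces. -/
def tangentMapAt (φ : M → N) (x : M) : E →L[ℝ] E' := mfderiv 𝓘(ℝ, E) 𝓘(ℝ, E') φ x

variable (E E') in
/-- A map read in the preferred charts at `x` and `φ x`. -/
def chartMap (φ : M → N) (x : M) : E → E' :=
  extChartAt 𝓘(ℝ, E') (φ x) ∘ φ ∘ (extChartAt 𝓘(ℝ, E) x).symm

omit [IsManifold 𝓘(ℝ, E) ∞ M] [IsManifold 𝓘(ℝ, E') ∞ N] in
theorem chartMap_self (φ : M → N) (x : M) :
    chartMap E E' φ x (extChartAt 𝓘(ℝ, E) x x) = extChartAt 𝓘(ℝ, E') (φ x) (φ x) := by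
  simp only [chartMap, Function.comp_apply, extChartAt_to_inv]

variable {φ : M → N} (hφ : ContMDiff 𝓘(ℝ, E) 𝓘(ℝ, E') ∞ φ)
include hφ

theorem contDiffAt_chartMap {x : M} {y : E} (hy : y ∈ (extChartAt 𝓘(ℝ, E) x).target)
    (hy' : φ ((extChartAt 𝓘(ℝ, E) x).symm y) ∈ (extChartAt 𝓘(ℝ, E') (φ x)).source) :
    ContDiffAt ℝ ∞ (chartMap E E' φ x) y := by
  have h1 : ContMDiffAt 𝓘(ℝ, E') 𝓘(ℝ, E') ∞ (extChartAt 𝓘(ℝ, E') (φ x))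
      ((φ ∘ (extChartAt 𝓘(ℝ, E) x).symm) y) := by
    rw [extChartAt_source] at hy'
    exact contMDiffAt_extChartAt' hy'
  exact (h1.comp y ((hφ _).comp y (contMDiffAt_symm x hy))).contDiffAt

/-- Chain rule for two expressions of the same map. It is needed on a neighbourhood, since the
kernel and determinant identities are later differentiated. -/
theorem chartDeriv_comp_fderiv_chartMap (x : M) :
    ∀ᶠ y in 𝓝 (extChartAt 𝓘(ℝ, E) x x),
      y ∈ (extChartAt 𝓘(ℝ, E) x).target ∧
      chartMap E E' φ x y ∈ (extChartAt 𝓘(ℝ, E') (φ x)).target ∧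
      (extChartAt 𝓘(ℝ, E') (φ x)).symm (chartMap E E' φ x y) =
        φ ((extChartAt 𝓘(ℝ, E) x).symm y) ∧
      ∀ u, chartDeriv (φ x) (chartMap E E' φ x y) (fderiv ℝ (chartMap E E' φ x) y u) =
        tangentMapAt E E' φ ((extChartAt 𝓘(ℝ, E) x).symm y) (chartDeriv x y u) := by
  have hsrc : ∀ᶠ y in 𝓝 (extChartAt 𝓘(ℝ, E) x x),
      φ ((extChartAt 𝓘(ℝ, E) x).symm y) ∈ (extChartAt 𝓘(ℝ, E') (φ x)).source := by
    have hc : ContinuousAt (φ ∘ (extChartAt 𝓘(ℝ, E) x).symm) (extChartAt 𝓘(ℝ, E) x x) :=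
      ((hφ _).comp _ (contMDiffAt_symm x (mem_extChartAt_target x))).continuousAt
    apply hc.eventually_mem
    simp only [Function.comp_apply, extChartAt_to_inv]
    exact extChartAt_source_mem_nhds (φ x)
  filter_upwards [(eventually_mem_target x).eventually_nhds, hsrc.eventually_nhds] with y h1 h2
  have h1' := h1.self_of_nhds
  have h2' := h2.self_of_nhds
  have ht : chartMap E E' φ x y ∈ (extChartAt 𝓘(ℝ, E') (φ x)).target :=
    (extChartAt 𝓘(ℝ, E') (φ x)).map_source h2'
  refine ⟨h1', ht, (extChartAt 𝓘(ℝ, E') (φ x)).left_inv h2', fun u => ?_⟩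
  have heq : (extChartAt 𝓘(ℝ, E') (φ x)).symm ∘ chartMap E E' φ x =ᶠ[𝓝 y]
      φ ∘ (extChartAt 𝓘(ℝ, E) x).symm := by
    filter_upwards [h2] with z hz using (extChartAt 𝓘(ℝ, E') (φ x)).left_inv hz
  have h3 := heq.mfderiv_eq (I := 𝓘(ℝ, E)) (I' := 𝓘(ℝ, E'))
  have hd : MDifferentiableAt 𝓘(ℝ, E) 𝓘(ℝ, E') (chartMap E E' φ x) y :=
    ((contDiffAt_chartMap hφ h1' h2').differentiableAt (by simp)).mdifferentiableAt
  have h4 := mfderiv_comp y ((contMDiffAt_symm (φ x) ht).mdifferentiableAt (by simp)) hd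
  have h5 := mfderiv_comp y ((hφ _).mdifferentiableAt (by simp))
    ((contMDiffAt_symm x h1').mdifferentiableAt (by simp))
  have h6 : (chartDeriv (φ x) (chartMap E E' φ x y)) ∘L (fderiv ℝ (chartMap E E' φ x) y) =
      (tangentMapAt E E' φ ((extChartAt 𝓘(ℝ, E) x).symm y)) ∘L (chartDeriv x y) := by
    rw [← mfderiv_eq_fderiv]
    exact h4.symm.trans (h3.trans h5)
  exact congrArg (fun L : E →L[ℝ] E' => L u) h6

end Submersion

/-! ### From the Jacobian to the Laplacian -/

section Laplacian

variable {E : Type*} [NormedAddCommGroup E] [NormedSpace ℝ E]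
  {M : Type*} [TopologicalSpace M] [ChartedSpace E M] [IsManifold 𝓘(ℝ, E) ∞ M]
  (g : ContMDiffRiemannianMetric 𝓘(ℝ, E) ∞ E (fun x : M => TangentSpace 𝓘(ℝ, E) x))
  {E' : Type*} [NormedAddCommGroup E'] [NormedSpace ℝ E']
  {N : Type*} [TopologicalSpace N] [ChartedSpace E' N] [IsManifold 𝓘(ℝ, E') ∞ N]
  (h : ContMDiffRiemannianMetric 𝓘(ℝ, E') ∞ E' (fun x : N => TangentSpace 𝓘(ℝ, E') x))

variable {g h} in
theorem IsPullbackSpectrum.exists_frame {φ : M → N} {x : M} {k : ℕ} {lam : Fin k → ℝ}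
    (hl : IsPullbackSpectrum g h φ x lam) :
    ∃ f : Fin k ⊕ Unit → E, IsOrthonormalFrame (metricAt g x) f ∧
      tangentMapAt E E' φ x (f (.inr ())) = 0 ∧
      ∀ i X, metricAt h (φ x) (tangentMapAt E E' φ x (f (.inl i))) (tangentMapAt E E' φ x X) =
        lam i ^ 2 * metricAt g x (f (.inl i)) X := by
  obtain ⟨-, e, u, hee, heu, huu, hs, hu0, hP⟩ := hl
  let f : Fin k ⊕ Unit → E := Sum.elim e fun _ => u
  have hee' : ∀ i j, metricAt g x (f (.inl i)) (f (.inl j)) = if i = j then 1 else 0 := hee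
  have heu' : ∀ i, metricAt g x (f (.inl i)) (f (.inr ())) = 0 := heu
  have huu' : metricAt g x (f (.inr ())) (f (.inr ())) = 1 := huu
  refine ⟨f, ⟨?_, ?_⟩, hu0, hP⟩
  · rintro (i | ⟨⟩) (j | ⟨⟩)
    · simpa using hee' i j
    · simpa using heu' i
    · rw [metricAt_symm]
      simpa using heu' j
    · simpa using huu'
  · rw [eq_top_iff]
    refine hs.ge.trans (Submodule.span_mono ?_)
    rintro v (rfl | ⟨i, rfl⟩)
    · exact ⟨.inr (), rfl⟩
    · exact ⟨.inl i, rfl⟩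

/-- The differential of the inverse chart is a linear isometry for `chartMetric`, so frames can be
pulled back through it. -/
theorem IsOrthonormalFrame.exists_chartMetric {ι : Type*} [Fintype ι] [DecidableEq ι] {x : M} {y : E}
    (hy : y ∈ (extChartAt 𝓘(ℝ, E) x).target) {f : ι → E}
    (hf : IsOrthonormalFrame (metricAt g ((extChartAt 𝓘(ℝ, E) x).symm y)) f) :
    ∃ f' : ι → E, (∀ a, chartDeriv x y (f' a) = f a) ∧
      IsOrthonormalFrame (chartMetric g x y) f' := by
  obtain ⟨e, he⟩ := chartDeriv_isInvertible hy
  have h1 : ∀ a, chartDeriv x y (e.symm (f a)) = f a := fun a => by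
    rw [← he]
    exact e.apply_symm_apply _
  refine ⟨fun a => e.symm (f a), h1, fun a c => ?_, ?_⟩
  · rw [chartMetric_apply, h1, h1, hf.apply_eq]
  · have : Set.range (fun a => e.symm (f a)) = e.symm.toLinearEquiv '' Set.range f := by
      rw [← Set.range_comp]
      rfl
    rw [this, ← LinearEquiv.coe_coe, Submodule.span_image, hf.span, Submodule.map_top,
      LinearEquiv.range]

theorem metricAt_gnorm (x : M) (v : TangentSpace 𝓘(ℝ, E) x) :
    gnorm g v ^ 2 = metricAt g x v v :=
  Real.sq_sqrt (metricAt_nonneg g x v)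

theorem divergence_eq_trace (X : (x : M) → TangentSpace 𝓘(ℝ, E) x) (x : M) :
    divergence g X x = LinearMap.trace ℝ E (nablaAt g X x).toLinearMap := rfl

/-- The Laplacian of a function `γ` whose gradient spans the fibres of a map with
Jacobian `c e^{aγ} |grad γ|`. -/
theorem laplacian_of_jacobian [FiniteDimensional ℝ E] [FiniteDimensional ℝ E']
    {φ : M → N} (hφ : ContMDiff 𝓘(ℝ, E) 𝓘(ℝ, E') ∞ φ)
    {γ : M → ℝ} (hγ : ContMDiff 𝓘(ℝ, E) 𝓘(ℝ, ℝ) ∞ γ) (hgrad : ∀ x, SmoothFieldAt (grad g γ) x)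
    (hker : ∀ x, tangentMapAt E E' φ x (valueAt (grad g γ) x) = 0)
    (hspan : ∀ x u, tangentMapAt E E' φ x u = 0 → ∃ s : ℝ, s • valueAt (grad g γ) x = u)
    {k : ℕ} {lam : M → Fin k → ℝ} (hlam : ∀ x, IsPullbackSpectrum g h φ x (lam x))
    {a c : ℝ} (hc : c ≠ 0)
    (hprod : ∀ x, ∏ i, lam x i = c * Real.exp (a * γ x) * gnorm g (grad g γ x)) (x : M) :
    laplacian g γ x + a * gnorm g (grad g γ x) ^ 2 = 0 := by
  set s := (extChartAt 𝓘(ℝ, E) x).symm with hs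
  set y₀ := extChartAt 𝓘(ℝ, E) x x with hy₀
  set V := chartField x (grad g γ) with hVdef
  -- The squared Jacobian without its factor `|grad γ|²`: the unit kernel vector is `r • V` with `r²
  -- |V|² = 1`, so that factor cancels when `θ(u)²` is written as `r² θ(V)²`.
  let R : E → ℝ := fun y => (c * Real.exp (a * (γ ∘ s) y)) ^ 2
  have hframe : ∀ᶠ y in 𝓝 y₀, ∃ f : Fin k ⊕ Unit → E,
      IsOrthonormalFrame (chartMetric g x y) f ∧
      (∃ r : ℝ, r • V y = f (.inr ())) ∧
      (∀ θ : E →L[ℝ] ℝ, ∀ b : Fin k ⊕ Unit → E,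
        (Matrix.of fun i j => pullbackForm (chartMetric h (φ x) (chartMap E E' φ x y))
          (fderiv ℝ (chartMap E E' φ x) y) (b i) (b j) + θ (b i) * θ (b j)).det =
        R y * θ (V y) ^ 2 * (Matrix.of fun i j => chartMetric g x y (b i) (b j)).det) := by
    filter_upwards [chartDeriv_comp_fderiv_chartMap hφ x] with y ⟨hy, hy', hsφ, hcomp⟩
    obtain ⟨f₁, hf₁, hu, hP⟩ := (hlam (s y)).exists_frame
    obtain ⟨f, hff, hf⟩ := hf₁.exists_chartMetric g hy
    obtain ⟨r, hr⟩ := hspan _ _ hu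
    have hrV : r • V y = f (.inr ()) := by
      apply chartDeriv_injective hy
      rw [map_smul, chartDeriv_chartField _ hy, hff]
      exact hr
    have hpb : ∀ u v, pullbackForm (chartMetric h (φ x) (chartMap E E' φ x y))
        (fderiv ℝ (chartMap E E' φ x) y) u v = metricAt h (φ (s y))
          (tangentMapAt E E' φ (s y) (chartDeriv x y u)) (tangentMapAt E E' φ (s y) (chartDeriv x y v)) := by
      intro u v
      have h1 : pullbackForm (chartMetric h (φ x) (chartMap E E' φ x y))
        (fderiv ℝ (chartMap E E' φ x) y) u v = chartMetric h (φ x) (chartMap E E' φ x y)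
        (fderiv ℝ (chartMap E E' φ x) y u) (fderiv ℝ (chartMap E E' φ x) y v) := rfl
      rw [h1, chartMetric_apply, hcomp, hcomp, hsφ]
    refine ⟨f, hf, ⟨r, hrV⟩, fun θ b => ?_⟩
    rw [hf.det_add_sq (lam := lam (s y)) (fun i X => ?_) (fun X => ?_) θ b]
    · congr 1
      have h1 := hf.apply_eq (.inr ()) (.inr ())
      rw [if_pos rfl, ← hrV, map_smul, map_smul, smul_apply, smul_eq_mul, smul_eq_mul,
        chartMetric_chartField g _ _ hy] at h1
      have h2 := metricAt_gnorm g (s y) (grad g γ (s y))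
      have h3 : r * (r * gnorm g (grad g γ (s y)) ^ 2) = 1 := by
        rw [h2]
        exact h1
      rw [hprod, ← hrV, map_smul, smul_eq_mul]
      simp only [R, Function.comp_apply]
      linear_combination ((c * Real.exp (a * γ (s y))) ^ 2 * θ (V y) ^ 2) * h3
    · rw [hpb, hff, hP, chartMetric_apply, hff]
    · rw [hpb, hff, hu, map_zero, zero_apply]
  have hself : chartMetric g x y₀ = metricAt g x := chartMetric_self g x
  obtain ⟨f, hf, ⟨r, hr⟩, -⟩ := hframe.self_of_nhds
  have hVy : V y₀ = valueAt (grad g γ) x := chartField_self x _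
  have hγd : DifferentiableAt ℝ (γ ∘ s) y₀ :=
    (contDiffAt_comp_symm hγ (mem_extChartAt_target x)).differentiableAt (by simp)
  have hγV : fderiv ℝ (γ ∘ s) y₀ (V y₀) = metricAt g x (V y₀) (V y₀) := by
    rw [← chartMetric_grad g hγ (mem_extChartAt_target x) (V y₀), hself]
  have hRd : HasFDerivAt R ((2 * a * R y₀) • fderiv ℝ (γ ∘ s) y₀) y₀ := by
    have h1 := (((hγd.hasFDerivAt.const_mul a).exp).const_mul c).pow 2
    refine h1.congr_fderiv ?_
    ext v
    simp [R]
    ring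
  have hR0 : R y₀ ≠ 0 := pow_ne_zero 2 (mul_ne_zero hc (Real.exp_ne_zero _))
  -- A multiple of `V` is a unit vector, so the gradient has no zeros.
  have hVV : chartMetric g x y₀ (V y₀) (V y₀) ≠ 0 := by
    intro h0
    have h1 := hf.apply_eq (.inr ()) (.inr ())
    rw [if_pos rfl, ← hr, map_smul, map_smul, smul_apply, h0] at h1
    simp at h1
  have hmain := divergence_formula (G := chartMetric g x) (H := chartMetric h (φ x))
    (φ := chartMap E E' φ x) (V := V) (R := R) (y := y₀)
    (fun u v => ((differentiableAt_chartMetric g x).clm_apply (differentiableAt_const u)).clm_apply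
      (differentiableAt_const v))
    (by rw [chartMap_self]; exact differentiableAt_chartMetric h (φ x))
    ((contDiffAt_chartMap hφ (mem_extChartAt_target x)
      (by rw [extChartAt_to_inv]; exact mem_extChartAt_source (φ x))).of_le (by norm_cast))
    (hgrad x).differentiableAt hRd.differentiableAt hR0 hVV
    (by
      filter_upwards [chartDeriv_comp_fderiv_chartMap hφ x] with y ⟨hy, hy', hsφ, hcomp⟩
      apply chartDeriv_injective hy'
      rw [hcomp, chartDeriv_chartField _ hy, hker, map_zero])
    (by filter_upwards [hframe] with y ⟨_, _, _, hd⟩ using hd) hf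
  have hdG : ∀ u v, fderiv ℝ (fun z => chartMetric g x z u v) y₀ (V y₀) =
      metricDeriv g x (V y₀) u v := by
    intro u v
    have := fderiv_chartMetric_apply g x (differentiableAt_const u) (differentiableAt_const v) (V y₀)
    simpa only [fderiv_fun_const, Pi.zero_apply, zero_apply, map_zero, add_zero] using this
  have htr : laplacian g γ x = ∑ i, metricAt g x (f i) (nablaAt g (grad g γ) x (f i)) := by
    rw [hself] at hf
    exact (divergence_eq_trace g (grad g γ) x).trans (hf.trace_eq _)
  rw [htr, metricAt_gnorm]
  simp only [hdG, hRd.fderiv, smul_apply, smul_eq_mul, hγV, hself] at hmain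
  -- On the diagonal two of the three Christoffel terms cancel, leaving half the metric derivative
  -- along `V`.
  have hterm : ∀ i, metricAt g x (f i) (nablaAt g (grad g γ) x (f i)) =
      metricAt g x (f i) (fderiv ℝ V y₀ (f i)) + 1 / 2 * metricDeriv g x (V y₀) (f i) (f i) := by
    intro i
    rw [metricAt_symm, metricAt_nablaAt, metricAt_symm g x (f i), hVy]
    ring
  simp only [hterm, Finset.sum_add_distrib, ← Finset.mul_sum]
  have hlast : metricAt g x (grad g γ x) (grad g γ x) = metricAt g x (V y₀) (V y₀) := by
    rw [hVy]
    rfl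
  rw [hlast]
  field_simp at hmain
  linarith

end Laplacian

/-! ### Constant multiples of Killing fields and gradients of logarithms -/

section Reparametrisation

variable {E : Type*} [NormedAddCommGroup E] [NormedSpace ℝ E] [FiniteDimensional ℝ E]
  {M : Type*} [TopologicalSpace M] [ChartedSpace E M] [IsManifold 𝓘(ℝ, E) ∞ M]
  (g : ContMDiffRiemannianMetric 𝓘(ℝ, E) ∞ E (fun x : M => TangentSpace 𝓘(ℝ, E) x))

variable {g} in
omit [FiniteDimensional ℝ E] in
theorem IsKillingField.const_smul [CompleteSpace E] {W : (x : M) → TangentSpace 𝓘(ℝ, E) x}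
    (hW : IsKillingField g W) (c : ℝ) : IsKillingField g (c • W) := by
  have : IsManifold 𝓘(ℝ, E) 2 M := .of_le (n := ∞) (by norm_cast)
  refine ⟨fun x => ContMDiffAt.const_smul_section (hW.1 x), fun x X Y hX hY => ?_⟩
  have hd := ContMDiffAt.mdifferentiableAt (hW.1 x) (by simp)
  have h1 : diffAt (fun y => metricAt g y (valueAt X y) (valueAt Y y)) x (valueAt W x) =
      metricAt g x (bracketAt W X x) (valueAt Y x) +
      metricAt g x (valueAt X x) (bracketAt W Y x) := hW.2 x X Y hX hY
  have hb : ∀ Z : (x : M) → TangentSpace 𝓘(ℝ, E) x,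
      bracketAt (c • W) Z x = c • bracketAt W Z x := fun Z =>
    VectorField.mlieBracket_const_smul_left (W := Z) hd
  have hv : valueAt (c • W) x = c • valueAt W x := rfl
  have h2 : diffAt (fun y => metricAt g y (valueAt X y) (valueAt Y y)) x (valueAt (c • W) x) =
      metricAt g x (bracketAt (c • W) X x) (valueAt Y x) +
      metricAt g x (valueAt X x) (bracketAt (c • W) Y x) := by
    rw [hb, hb, hv, map_smul, map_smul, map_smul, smul_apply, h1, smul_add]
  exact h2

omit [FiniteDimensional ℝ E] [IsManifold 𝓘(ℝ, E) ∞ M] in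
theorem contMDiff_const_mul_log {F : M → ℝ} (hF : ContMDiff 𝓘(ℝ, E) 𝓘(ℝ, ℝ) ∞ F)
    (hpos : ∀ x, 0 < F x) (c : ℝ) :
    ContMDiff 𝓘(ℝ, E) 𝓘(ℝ, ℝ) ∞ (fun x => c * Real.log (F x)) := fun x =>
  ((contDiffAt_const.mul (Real.contDiffAt_log.2 (hpos x).ne')).contMDiffAt).comp x (hF x)

theorem grad_const_mul_log {F : M → ℝ} (hF : ContMDiff 𝓘(ℝ, E) 𝓘(ℝ, ℝ) ∞ F)
    (hpos : ∀ x, 0 < F x) (c : ℝ) (x : M) :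
    grad g (fun x => c * Real.log (F x)) x = (c * (F x)⁻¹) • grad g F x := by
  have hdF := contDiffAt_comp_symm hF (mem_extChartAt_target (I := 𝓘(ℝ, E)) x)
  have h1 := (((hdF.differentiableAt (by simp)).hasFDerivAt.log (by
    simpa using (hpos x).ne')).const_mul c).fderiv
  have h2 : ∀ v : E, diffAt (fun x => c * Real.log (F x)) x v = (c * (F x)⁻¹) * diffAt F x v := by
    intro v
    rw [diffAt_eq_fderiv ((contMDiff_const_mul_log hF hpos c x).mdifferentiableAt (by simp)),
      diffAt_eq_fderiv ((hF x).mdifferentiableAt (by simp))]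
    have h3 := congrArg (fun L : E →L[ℝ] ℝ => L v) h1
    refine h3.trans ?_
    simp only [smul_apply, smul_eq_mul, Function.comp_apply, extChartAt_to_inv]
    ring
  have h4 : valueAt (grad g (fun x => c * Real.log (F x))) x =
      (c * (F x)⁻¹) • valueAt (grad g F) x := by
    refine metricAt_ext g x fun w => ?_
    rw [map_smul, smul_apply, metricAt_grad, metricAt_grad, h2, smul_eq_mul]
  exact h4

end Reparametrisation

/-! ### The two cases of the theorem -/

section Biharmonic

variable {E : Type*} [NormedAddCommGroup E] [NormedSpace ℝ E] [FiniteDimensional ℝ E]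
  {M : Type*} [TopologicalSpace M] [ChartedSpace E M] [IsManifold 𝓘(ℝ, E) ∞ M]
  {g : ContMDiffRiemannianMetric 𝓘(ℝ, E) ∞ E (fun x : M => TangentSpace 𝓘(ℝ, E) x)}
  {J : (x : M) → TangentSpace 𝓘(ℝ, E) x →L[ℝ] TangentSpace 𝓘(ℝ, E) x}
  {E' : Type*} [NormedAddCommGroup E'] [NormedSpace ℝ E'] [FiniteDimensional ℝ E']
  {N : Type*} [TopologicalSpace N] [ChartedSpace E' N] [IsManifold 𝓘(ℝ, E') ∞ N]
  {h : ContMDiffRiemannianMetric 𝓘(ℝ, E') ∞ E' (fun x : N => TangentSpace 𝓘(ℝ, E') x)}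
  {φ : M → N} {F : M → ℝ} {k : ℕ} {lam : M → Fin k → ℝ}

theorem isBiharmonicFactor_log (hJ : IsKahler g J) (hφ : ContMDiff 𝓘(ℝ, E) 𝓘(ℝ, E') ∞ φ)
    (hF : ContMDiff 𝓘(ℝ, E) 𝓘(ℝ, ℝ) ∞ F) (hpos : ∀ x, 0 < F x)
    (hker : ∀ x, tangentMapAt E E' φ x (valueAt (grad g F) x) = 0)
    (hspan : ∀ x u, tangentMapAt E E' φ x u = 0 → ∃ s : ℝ, s • valueAt (grad g F) x = u)
    (hhol : IsHolomorphicField J (grad g F)) (hlam : ∀ x, IsPullbackSpectrum g h φ x (lam x))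
    {m : ℕ} (hm : m ≠ 6)
    (hprod : ∀ x, ∏ i, lam x i = F x ^ (4 / ((m : ℝ) - 6)) * gnorm g (grad g F x)) :
    IsBiharmonicFactor g m J (fun x => 2 / ((m : ℝ) - 6) * Real.log (F x)) := by
  have hm' : (m : ℝ) - 6 ≠ 0 := sub_ne_zero.2 (by exact_mod_cast hm)
  set c : ℝ := 2 / ((m : ℝ) - 6) with hc
  have hc0 : c ≠ 0 := div_ne_zero two_ne_zero hm'
  have hγ := contMDiff_const_mul_log hF hpos c
  have hgrad := grad_const_mul_log g hF hpos c
  have hval : ∀ x, valueAt (grad g fun x => c * Real.log (F x)) x =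
      (c * (F x)⁻¹) • valueAt (grad g F) x := hgrad
  have hcF : ∀ x, c * (F x)⁻¹ ≠ 0 := fun x => mul_ne_zero hc0 (inv_ne_zero (hpos x).ne')
  refine ⟨hγ, ?_, fun x => ?_⟩
  -- Since `e^{(m-6)γ/2} = F` and `grad γ = c F⁻¹ grad F`, the field is `c • J (grad F)`.
  · convert (hJ.isKillingField_grad hF hhol).const_smul c using 1
    funext x
    have he : Real.exp (((m : ℝ) - 6) / 2 * (c * Real.log (F x))) = F x := by
      rw [hc, show ((m : ℝ) - 6) / 2 * (2 / ((m : ℝ) - 6) * Real.log (F x)) = Real.log (F x) by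
        field_simp, Real.exp_log (hpos x)]
    rw [he, hgrad, smul_smul, show F x * (c * (F x)⁻¹) = c by
      field_simp [(hpos x).ne'], map_smul]
    rfl
  -- The constant compensates `|grad γ| = |c| F⁻¹ |grad F|`; the absolute value matters for `m < 6`,
  -- where `c` is negative.
  · refine laplacian_of_jacobian (c := |c|⁻¹) g h hφ hγ (fun x => ?_) (fun x => ?_)
      (fun x u hu => ?_) hlam (inv_ne_zero (abs_ne_zero.2 hc0)) (fun x => ?_) x
    · have hinv : ContMDiffAt 𝓘(ℝ, E) 𝓘(ℝ, ℝ) ∞ (fun x => c * (F x)⁻¹) x :=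
        ((contDiffAt_const.mul (contDiffAt_inv ℝ (hpos x).ne')).contMDiffAt).comp x (hF x)
      have h1 := ContMDiffAt.smul_section hinv (hhol.1 x)
      have h2 : (grad g fun x => c * Real.log (F x)) = (fun x => c * (F x)⁻¹) • grad g F :=
        funext hgrad
      unfold SmoothFieldAt
      rw [h2]
      exact h1
    · rw [hval, map_smul, hker, smul_zero]
    · obtain ⟨s, hs⟩ := hspan x u hu
      refine ⟨s * (c * (F x)⁻¹)⁻¹, ?_⟩
      rw [hval, smul_smul, inv_mul_cancel_right₀ (hcF x), hs]
    · have hnorm : gnorm g (grad g (fun x => c * Real.log (F x)) x) =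
          |c| * (F x)⁻¹ * gnorm g (grad g F x) := by
        have h1 : gnorm g (grad g (fun x => c * Real.log (F x)) x) =
            Real.sqrt (metricAt g x (valueAt (grad g fun x => c * Real.log (F x)) x)
              (valueAt (grad g fun x => c * Real.log (F x)) x)) := rfl
        rw [h1, hval, map_smul, map_smul, smul_apply, smul_eq_mul, smul_eq_mul, ← mul_assoc,
          Real.sqrt_mul (mul_self_nonneg _), Real.sqrt_mul_self_eq_abs, abs_mul,
          abs_of_pos (inv_pos.2 (hpos x))]
        rfl
      -- The exponent is `(m-2)/(m-6) = 4/(m-6) + 1`; the extra factor `F` cancels the `F⁻¹` in the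
      -- norm of `grad γ`.
      have hexp : Real.exp (((m : ℝ) - 2) / 2 * (c * Real.log (F x))) =
          F x ^ (4 / ((m : ℝ) - 6)) * F x := by
        rw [Real.rpow_def_of_pos (hpos x)]
        nth_rewrite 3 [← Real.exp_log (hpos x)]
        rw [← Real.exp_add, hc]
        congr 1
        field_simp
        ring
      rw [hprod, hnorm, hexp]
      have := (hpos x).ne'
      have := abs_ne_zero.2 hc0
      field_simp

/-- For `m = 6` the conformal weight `(m-6)/2` vanishes and `(m-2)/2 = 2`, so `F` itself serves as
`γ` without reparametrisation. -/
theorem isBiharmonicFactor_six (hJ : IsKahler g J) (hφ : ContMDiff 𝓘(ℝ, E) 𝓘(ℝ, E') ∞ φ)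
    (hF : ContMDiff 𝓘(ℝ, E) 𝓘(ℝ, ℝ) ∞ F)
    (hker : ∀ x, tangentMapAt E E' φ x (valueAt (grad g F) x) = 0)
    (hspan : ∀ x u, tangentMapAt E E' φ x u = 0 → ∃ s : ℝ, s • valueAt (grad g F) x = u)
    (hhol : IsHolomorphicField J (grad g F)) (hlam : ∀ x, IsPullbackSpectrum g h φ x (lam x))
    (hprod : ∀ x, ∏ i, lam x i = Real.exp (2 * F x) * gnorm g (grad g F x)) :
    IsBiharmonicFactor g 6 J F := by
  refine ⟨hF, ?_, fun x => ?_⟩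
  · convert hJ.isKillingField_grad hF hhol using 1
    funext x
    rw [show Real.exp ((((6 : ℕ) : ℝ) - 6) / 2 * F x) = 1 by norm_num, one_smul]
  · refine laplacian_of_jacobian (c := 1) g h hφ hF hhol.1 hker hspan hlam one_ne_zero
      (fun x => ?_) x
    rw [hprod]
    norm_num

end Biharmonic

end KahlerSubmersion

end

theorem proposition5 {m : ℕ}
    {M : Type*} [TopologicalSpace M] [ChartedSpace (EuclideanSpace ℝ (Fin m)) M]
    [IsManifold (𝓡 m) ∞ M]
    {N : Type*} [TopologicalSpace N] [ChartedSpace (EuclideanSpace ℝ (Fin (m - 1))) N]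
    [IsManifold (𝓡 (m - 1)) ∞ N]
    (g : ContMDiffRiemannianMetric (𝓡 m) ∞ (EuclideanSpace ℝ (Fin m))
      (fun x : M => TangentSpace (𝓡 m) x))
    (J : (x : M) → TangentSpace (𝓡 m) x →L[ℝ] TangentSpace (𝓡 m) x)
    (hJ : IsKahler g J)
    (h : ContMDiffRiemannianMetric (𝓡 (m - 1)) ∞ (EuclideanSpace ℝ (Fin (m - 1)))
      (fun x : N => TangentSpace (𝓡 (m - 1)) x))
    (φ : M → N) (hφ : IsSubmersion (𝓡 m) (𝓡 (m - 1)) ∞ φ)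
    (F : M → ℝ) (hF : ContMDiff (𝓡 m) 𝓘(ℝ, ℝ) ∞ F) (hFpos : ∀ x, 0 < F x)
    (hfib : ∀ x, (mfderiv (𝓡 m) (𝓡 (m - 1)) φ x).ker = Submodule.span ℝ {grad g F x})
    (hhol : IsHolomorphicField J (grad g F))
    (lam : M → Fin (m - 1) → ℝ) (hlam : ∀ x, IsPullbackSpectrum g h φ x (lam x)) :
    (m ≠ 6 →
      (∀ x, ∏ i, lam x i = F x ^ (4 / ((m : ℝ) - 6)) * gnorm g (grad g F x)) →
      IsBiharmonicFactor g m J (fun x => 2 / ((m : ℝ) - 6) * Real.log (F x))) ∧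
    (m = 6 →
      (∀ x, ∏ i, lam x i = Real.exp (2 * F x) * gnorm g (grad g F x)) →
      IsBiharmonicFactor g m J F) := by
  have hker : ∀ x,
      tangentMapAt (EuclideanSpace ℝ (Fin m)) (EuclideanSpace ℝ (Fin (m - 1))) φ x
        (valueAt (grad g F) x) = 0 := fun x => by
    have h1 : grad g F x ∈ (mfderiv (𝓡 m) (𝓡 (m - 1)) φ x).ker := by
      rw [hfib x]
      exact Submodule.mem_span_singleton_self _
    exact h1
  have hspan : ∀ x u,
      tangentMapAt (EuclideanSpace ℝ (Fin m)) (EuclideanSpace ℝ (Fin (m - 1))) φ x u = 0 →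
        ∃ s : ℝ, s • valueAt (grad g F) x = u := by
    intro x u hu
    have h1 : (u : TangentSpace (𝓡 m) x) ∈ (mfderiv (𝓡 m) (𝓡 (m - 1)) φ x).ker := hu
    rw [hfib x] at h1
    exact Submodule.mem_span_singleton.1 h1
  refine ⟨fun hm hprod => isBiharmonicFactor_log hJ hφ.contMDiff hF hFpos hker hspan hhol hlam hm
    hprod, ?_⟩
  rintro rfl hprod
  exact isBiharmonicFactor_six hJ hφ.contMDiff hF hker hspan hhol hlam hprod
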